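/- Let $d\ge 1$, $\lambda>0$, $\alpha>d$, $\theta>0$, $W>0$, $N_0\ge 0$ and $x_0\in\mathbb R^d\setminus\{0\}$, $r_0=|x_0|$. A receiver is at the origin, its transmitter is at $x_0$, and the other transmitters form a homogeneous Poisson point process $\{x_1,x_2,\dots\}\subset\mathbb R^d$ of intensity $\lambda$. Time is slotted. In slot $k$ the node $x$ has a fading coefficient $h_{k,x}$ towards the receiver; these are i.i.d. exponential with mean $1$, and independent of the locations. Put $$\delta=\frac d\alpha,\quad C(\delta)=\frac{1}{\mathrm{sinc}(\delta)}=\frac{\pi\delta}{\sin(\pi\delta)},\quad A=\lambda c_d r_0^d\theta^{\delta}C(\delta),\quad B=\theta r_0^{\alpha}WN_0,$$ where $c_d$ is the volume of the $d$-dimensional unit ball. ALOHA with transmit probability $p\in(0,1]$: in every slot every node transmits with probability $p$, independently over nodes and slots and of the locations and the fading. A slot $k$ is successful if $x_0$ transmits in it and $$\mathrm{SINR}_k=\frac{h_{k,x_0}r_0^{-\alpha}}{WN_0+\sum_{i\ge1}h_{k,x_i}|x_i|^{-\alpha}\mathbf 1(x_i\text{ transmits in slot }k)}>\theta .$$ The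 local delay is the number of slots up to and including the first successful one; its mean is denoted by $\widetilde D(p)$. FHMA with $N\ge1$ sub-bands: in every slot every node chooses one of $N$ sub-bands uniformly at random, independently over nodes and slots and of the locations and the fading. A slot $k$ is successful if $$\frac{h_{k,x_0}r_0^{-\alpha}}{WN_0/N+\sum_{i\ge1}h_{k,x_i}|x_i|^{-\alpha}\mathbf 1(x_i\text{ uses the sub-band of }x_0\text{ in slot }k)}>\theta ,$$ and the local delay is the number of slots until $N$ slots have been successful; its mean is denoted by $D(N)$. Theorem. For $0<p<1$, $$\widetilde D(p)=\frac1p\exp\left(\frac{pA}{(1-p)^{1-\delta}}+B\right),$$ and $\widetilde D(1)=\infty$. If the noise is ignored ($N_0=0$), then $\widetilde D(1/N)=D(N)$ for every integer $N\ge1$ (both sides being $\infty$ for $N=1$). -/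

import Mathlib

open MeasureTheory ProbabilityTheory
open scoped ENNReal NNReal

noncomputable section

/-- The random counting measure `∑ i, δ_{X i ω}` of a random sequence of points. -/
def countingMeasure {Ω E : Type*} [MeasurableSpace E] (X : ℕ → Ω → E) (ω : Ω) : Measure E :=
  Measure.sum fun i => Measure.dirac (X i ω)

/-- The random points `X 0, X 1, …` form a Poisson point process with intensity measure `Λ`:
the number of points in a measurable set `B` of finite intensity is Poisson distributed with
mean `Λ B`, and the numbers of points in pairwise disjoint measurable sets are independent. -/
structure IsPoissonPointProcess {Ω E : Type*} [MeasurableSpace Ω] [MeasurableSpace E]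
    (P : Measure Ω) (Λ : Measure E) (X : ℕ → Ω → E) : Prop where
  measurable : ∀ i, Measurable (X i)
  law_count : ∀ B : Set E, MeasurableSet B → Λ B ≠ ∞ →
    HasLaw (fun ω => countingMeasure X ω B)
      ((poissonMeasure (Λ B).toNNReal).map fun n : ℕ => (n : ℝ≥0∞)) P
  indep_count : ∀ (n : ℕ) (B : Fin n → Set E), (∀ j, MeasurableSet (B j)) →
    Pairwise (fun i j => Disjoint (B i) (B j)) →
    iIndepFun (fun j ω => countingMeasure X ω (B j)) P

/-- Parameters of the Poisson bipolar model in `ℝ^d`, with the receiver of the typical link at the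
origin. The path loss exponent exceeds the dimension. -/
structure LinkParams (d : ℕ) where
  /-- intensity of the transmitters -/
  lam : ℝ
  /-- path loss exponent -/
  alpha : ℝ
  /-- location of the desired transmitter -/
  x₀ : EuclideanSpace ℝ (Fin d)
  /-- SINR threshold -/
  theta : ℝ
  /-- total bandwidth -/
  W : ℝ
  /-- normalized noise power spectral density -/
  N₀ : ℝ
  lam_pos : 0 < lam
  alpha_gt : (d : ℝ) < alpha
  x₀_ne : x₀ ≠ 0
  theta_pos : 0 < theta
  W_pos : 0 < W
  N₀_nonneg : 0 ≤ N₀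

namespace LinkParams

variable {d : ℕ} (L : LinkParams d)

/-- The link distance. -/
def r₀ : ℝ := ‖L.x₀‖

def delta : ℝ := d / L.alpha

/-- `C(δ) = 1 / sinc δ` for the normalized `sinc δ = sin (π δ) / (π δ)`;
`Real.sinc` is the unnormalized function `sin x / x`. -/
def C : ℝ := 1 / Real.sinc (Real.pi * L.delta)

/-- The volume of the `d`-dimensional unit ball. -/
def unitBallVolume (d : ℕ) : ℝ := (volume (Metric.ball (0 : EuclideanSpace ℝ (Fin d)) 1)).toReal

def A : ℝ := L.lam * unitBallVolume d * L.r₀ ^ d * L.theta ^ L.delta * L.C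

def B : ℝ := L.theta * L.r₀ ^ L.alpha * L.W * L.N₀

end LinkParams

/-- The transmitters: `none` is the desired transmitter, located at `x₀`, and `some i` is the
`i`-th interferer. -/
abbrev Node := Option ℕ

/-- The Poisson bipolar network seen from the typical receiver. Given the desired transmitter
`x₀`, the other transmitters `X 0, X 1, …` form a homogeneous Poisson point process. In slot `k`
the node `x` has the fading coefficient `h k x` towards the receiver and the MAC state `m k x`.
The fading coefficients are i.i.d. exponential with unit mean, the MAC states are independent, and
locations, fading and MAC are independent of each other. -/
structure IsBipolarNetwork {d : ℕ} (L : LinkParams d) {Ω M : Type*} [MeasurableSpace Ω]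
    [MeasurableSpace M] (P : Measure Ω) (X : ℕ → Ω → EuclideanSpace ℝ (Fin d))
    (h : ℕ → Node → Ω → ℝ) (m : ℕ → Node → Ω → M) : Prop where
  poisson : IsPoissonPointProcess P (ENNReal.ofReal L.lam • volume) X
  measurable_fading : ∀ k x, Measurable (h k x)
  law_fading : ∀ k x, HasLaw (h k x) (expMeasure 1) P
  measurable_mac : ∀ k x, Measurable (m k x)
  indep_fading : iIndepFun (fun (q : ℕ × Node) => h q.1 q.2) P
  indep_mac : iIndepFun (fun (q : ℕ × Node) => m q.1 q.2) P
  indep_fading_mac :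
    IndepFun (fun ω (q : ℕ × Node) => h q.1 q.2 ω) (fun ω (q : ℕ × Node) => m q.1 q.2 ω) P
  indep_points :
    IndepFun (fun ω i => X i ω)
      (fun ω => ((fun q : ℕ × Node => h q.1 q.2 ω), (fun q : ℕ × Node => m q.1 q.2 ω))) P

/-- ALOHA: every node transmits in every slot with probability `p`. -/
structure IsAloha {d : ℕ} (L : LinkParams d) (p : ℝ) {Ω : Type*} [MeasurableSpace Ω]
    (P : Measure Ω) (X : ℕ → Ω → EuclideanSpace ℝ (Fin d)) (h : ℕ → Node → Ω → ℝ)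
    (a : ℕ → Node → Ω → Bool) : Prop extends IsBipolarNetwork L P X h a where
  prob_transmit : ∀ k x, P {ω | a k x ω = true} = ENNReal.ofReal p

/-- FHMA: every node chooses in every slot one of the `N` sub-bands uniformly at random. -/
structure IsFhma {d : ℕ} (L : LinkParams d) (N : ℕ) {Ω : Type*} [MeasurableSpace Ω]
    (P : Measure Ω) (X : ℕ → Ω → EuclideanSpace ℝ (Fin d)) (h : ℕ → Node → Ω → ℝ)
    (S : ℕ → Node → Ω → Fin N) : Prop extends IsBipolarNetwork L P X h S where
  prob_subband : ∀ k x s, P {ω | S k x ω = s} = (N : ℝ≥0∞)⁻¹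

section Delay

variable {d : ℕ} (L : LinkParams d) {Ω : Type*} (X : ℕ → Ω → EuclideanSpace ℝ (Fin d))
  (h : ℕ → Node → Ω → ℝ)

open Classical in
/-- The interference `∑ h_{k,x} |x|^{-α}` over those interferers that satisfy `active`. -/
def interference (k : ℕ) (active : ℕ → Prop) (ω : Ω) : ℝ≥0∞ :=
  ∑' i, if active i then ENNReal.ofReal (h k (some i) ω) * ‖X i ω‖ₑ ^ (-L.alpha) else 0

/-- The signal to interference and noise ratio at noise power `noise`. -/
def sinr (k : ℕ) (noise : ℝ) (active : ℕ → Prop) (ω : Ω) : ℝ≥0∞ :=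
  ENNReal.ofReal (h k none ω * L.r₀ ^ (-L.alpha)) /
    (ENNReal.ofReal noise + interference L X h k active ω)

/-- In ALOHA, slot `k` is successful if the desired transmitter transmits and the SINR exceeds
the threshold; the whole band is used, with noise `W N₀`. -/
def AlohaSuccess (a : ℕ → Node → Ω → Bool) (k : ℕ) (ω : Ω) : Prop :=
  a k none ω = true ∧
    ENNReal.ofReal L.theta < sinr L X h k (L.W * L.N₀) (fun i => a k (some i) ω = true) ω

/-- In FHMA, slot `k` is successful if the SINR exceeds the threshold, where only the
transmitters in the sub-band of the desired one interfere and the noise is `W N₀ / N`. -/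
def FhmaSuccess {N : ℕ} (S : ℕ → Node → Ω → Fin N) (k : ℕ) (ω : Ω) : Prop :=
  ENNReal.ofReal L.theta <
    sinr L X h k (L.W * L.N₀ / N) (fun i => S k (some i) ω = S k none ω) ω

open Classical in
/-- The number of slots until `n` slots have been successful (`∞` if this never happens);
the slots are numbered `0, 1, …`, so that `k + 1` slots have elapsed after slot `k`. -/
def slotsUntil (n : ℕ) (success : ℕ → Prop) : ℝ≥0∞ :=
  ⨅ (k : ℕ) (_ : n ≤ ((Finset.range (k + 1)).filter success).card), ((k : ℝ≥0∞) + 1)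

/-- Local delay of ALOHA: one successful slot is needed. -/
def alohaDelay (a : ℕ → Node → Ω → Bool) (ω : Ω) : ℝ≥0∞ :=
  slotsUntil 1 fun k => AlohaSuccess L X h a k ω

/-- Local delay of FHMA with `N` sub-bands: `N` successful slots are needed. -/
def fhmaDelay {N : ℕ} (S : ℕ → Node → Ω → Fin N) (ω : Ω) : ℝ≥0∞ :=
  slotsUntil N fun k => FhmaSuccess L X h S k ω

end Delay

end

/-! Slots are dependent only through the common locations. Given the locations `x`, they are i.i.d.,
so the mean number of slots until `n` successes is `n / q(x)`, where `q(x)` is the conditional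
success probability of a slot. The mean delay is therefore the expectation of `n / q` over the
Poisson process.

Put `κ = θ r₀^α` and `u_i = κ |x_i|^(-α)`. Success means that the exponential fading of the desired
link exceeds `κ` times noise plus interference. The exponential tail turns this into a Laplace
transform, so for ALOHA `q(x) = p e^(-B) ∏ (1 - p + p / (1 + u_i))`. Hence `1 / q` is a constant
times `exp (∑ g(x_i))` with `e^(-g) = 1 - p + p / (1 + u)`, and the probability generating
functional gives mean `exp (∫ (e^g - 1) dΛ)` for that exponential. The integrand is `pκ / (|x|^α +
(1 - p)κ)`. Its integral is `p A / (1 - p)^(1 - δ)` for `p < 1`; at `p = 1` the singularity at the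
origin is not integrable, since `α > d`.

For FHMA, conditioning on the sub-band of the desired transmitter gives the same product with `p =
1/N` but without the prefactor `p`, while `N` successes are needed. So `N / q` for FHMA and `1 / q`
for ALOHA coincide when there is no noise. The two means agree as the same functional of `Λ`, before
any integral is evaluated, which includes the infinite case `N = 1`.

All expectations are taken in `[0, ∞]`, so that infinite delays and infinite interference need no
separate integrability theory. -/

noncomputable section

/-! ### Exponential and logarithm with values in `[0, ∞]` -/

/-- The exponential function on `[0, ∞]`. -/
def eexp (x : ℝ≥0∞) : ℝ≥0∞ := EReal.exp (x : EReal)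

@[simp] lemma eexp_zero : eexp 0 = 1 := by simp [eexp]

@[simp] lemma eexp_top : eexp ∞ = ∞ := by simp [eexp]

lemma eexp_add (x y : ℝ≥0∞) : eexp (x + y) = eexp x * eexp y := by
  simp [eexp, EReal.exp_add]

lemma eexp_sum {ι : Type*} (s : Finset ι) (f : ι → ℝ≥0∞) :
    eexp (∑ i ∈ s, f i) = ∏ i ∈ s, eexp (f i) := by
  classical
  induction s using Finset.induction_on with
  | empty => simp
  | insert i s hi ih => rw [Finset.sum_insert hi, Finset.prod_insert hi, eexp_add, ih]

lemma eexp_nat_mul (n : ℕ) (x : ℝ≥0∞) : eexp (n * x) = eexp x ^ n := by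
  induction n with
  | zero => simp
  | succ n ih => rw [Nat.cast_succ, add_mul, one_mul, eexp_add, ih, pow_succ]

lemma eexp_mono : Monotone eexp := fun _ _ h =>
  EReal.exp_monotone (EReal.coe_ennreal_le_coe_ennreal_iff.2 h)

lemma continuous_eexp : Continuous eexp :=
  ENNReal.continuous_exp.comp continuous_coe_ennreal_ereal

lemma measurable_eexp : Measurable eexp := continuous_eexp.measurable

lemma one_le_eexp (x : ℝ≥0∞) : 1 ≤ eexp x := by
  simpa using eexp_mono (zero_le (a := x))

lemma eexp_ne_zero (x : ℝ≥0∞) : eexp x ≠ 0 := (zero_lt_one.trans_le (one_le_eexp x)).ne'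

lemma eexp_ofReal {x : ℝ} (hx : 0 ≤ x) :
    eexp (ENNReal.ofReal x) = ENNReal.ofReal (Real.exp x) := by
  rw [eexp, EReal.coe_ennreal_ofReal, max_eq_left (by exact_mod_cast hx), EReal.exp_coe]

lemma eexp_ne_top {x : ℝ≥0∞} (hx : x ≠ ∞) : eexp x ≠ ∞ := by
  simpa [eexp] using hx

lemma eexp_inv_add (x y : ℝ≥0∞) : (eexp (x + y))⁻¹ = (eexp x)⁻¹ * (eexp y)⁻¹ := by
  rw [eexp_add, ENNReal.mul_inv (Or.inl (eexp_ne_zero _)) (Or.inr (eexp_ne_zero _))]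

/-- The logarithm on `[1, ∞]`. -/
def elog (y : ℝ≥0∞) : ℝ≥0∞ := (ENNReal.log y).toENNReal

lemma measurable_elog : Measurable elog :=
  measurable_ereal_toENNReal.comp ENNReal.measurable_log

lemma eexp_elog {y : ℝ≥0∞} (hy : 1 ≤ y) : eexp (elog y) = y := by
  have h0 : 0 ≤ ENNReal.log y := by
    rw [← EReal.one_le_exp_iff, ENNReal.exp_log]; exact hy
  rw [eexp, elog, EReal.coe_toENNReal h0, ENNReal.exp_log]

lemma eexp_iSup {f : ℕ → ℝ≥0∞} (hf : Monotone f) : eexp (⨆ n, f n) = ⨆ n, eexp (f n) :=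
  tendsto_nhds_unique ((continuous_eexp.tendsto _).comp (tendsto_atTop_iSup hf))
    (tendsto_atTop_iSup (eexp_mono.comp hf))

/-! ### Exponential moments of Poisson point processes -/

/-- The moment generating function of the Poisson distribution. -/
lemma lintegral_eexp_poissonMeasure (r : ℝ≥0) {c : ℝ≥0∞} (hc : c ≠ ∞) :
    ∫⁻ n : ℕ, eexp (c * n) ∂(poissonMeasure r) = eexp ((eexp c - 1) * r) := by
  lift c to ℝ≥0 using hc
  have hy : eexp (c : ℝ≥0∞) = ENNReal.ofReal (Real.exp c) := by
    rw [← eexp_ofReal c.coe_nonneg, ENNReal.ofReal_coe_nnreal]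
  have h1 : (eexp (c : ℝ≥0∞) - 1) * r = ENNReal.ofReal ((Real.exp c - 1) * r) := by
    rw [hy, ← ENNReal.ofReal_one, ← ENNReal.ofReal_sub _ zero_le_one,
      ENNReal.ofReal_mul (by linarith [Real.one_le_exp c.coe_nonneg]), ENNReal.ofReal_coe_nnreal]
  have hge : 0 ≤ (Real.exp c - 1) * r :=
    mul_nonneg (by linarith [Real.one_le_exp c.coe_nonneg]) r.coe_nonneg
  have hs := (NormedSpace.expSeries_div_hasSum_exp ((r : ℝ) * Real.exp c)).mul_left
    (Real.exp (-r))
  rw [← Real.exp_eq_exp_ℝ, ← Real.exp_add] at hs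
  rw [h1, eexp_ofReal hge, poissonMeasure, lintegral_sum_measure,
    show (Real.exp c - 1) * r = -r + r * Real.exp c by ring, ← hs.tsum_eq,
    ENNReal.ofReal_tsum_of_nonneg (fun n => by positivity) hs.summable]
  refine tsum_congr fun n => ?_
  rw [lintegral_smul_measure, lintegral_dirac, mul_comm (c : ℝ≥0∞), eexp_nat_mul, hy,
    smul_eq_mul, ← ENNReal.ofReal_pow (Real.exp_pos _).le, ← ENNReal.ofReal_mul (by positivity)]
  congr 1
  rw [mul_pow]; ring

lemma countingMeasure_apply {Ω E : Type*} [MeasurableSpace E] (X : ℕ → Ω → E) (ω : Ω)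
    {B : Set E} (hB : MeasurableSet B) :
    countingMeasure X ω B = ∑' i, B.indicator 1 (X i ω) := by
  simp [countingMeasure, Measure.sum_apply _ hB, Measure.dirac_apply' _ hB]

lemma lintegral_countingMeasure {Ω E : Type*} [MeasurableSpace E] (X : ℕ → Ω → E) (ω : Ω)
    {g : E → ℝ≥0∞} (hg : Measurable g) :
    ∫⁻ x, g x ∂(countingMeasure X ω) = ∑' i, g (X i ω) := by
  simp [countingMeasure, lintegral_sum_measure, lintegral_dirac' _ hg]

namespace IsPoissonPointProcess

variable {Ω E : Type*} [MeasurableSpace Ω] [MeasurableSpace E] {P : Measure Ω} {Λ : Measure E}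
  {X : ℕ → Ω → E}

lemma measurable_count (hX : IsPoissonPointProcess P Λ X) {B : Set E} (hB : MeasurableSet B) :
    Measurable fun ω => countingMeasure X ω B := by
  simp_rw [countingMeasure_apply X _ hB]
  exact Measurable.tsum fun i => (measurable_one.indicator hB).comp (hX.measurable i)

lemma lintegral_eexp_mul_count (hX : IsPoissonPointProcess P Λ X) {B : Set E}
    (hB : MeasurableSet B) (hΛ : Λ B ≠ ∞) {c : ℝ≥0∞} (hc : c ≠ ∞) :
    ∫⁻ ω, eexp (c * countingMeasure X ω B) ∂P = eexp ((eexp c - 1) * Λ B) := by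
  have hm : Measurable fun y : ℝ≥0∞ => eexp (c * y) :=
    measurable_eexp.comp (measurable_id.const_mul c)
  rw [(hX.law_count B hB hΛ).lintegral_comp (f := fun y => eexp (c * y)) hm.aemeasurable,
    lintegral_map hm (measurable_of_countable _), lintegral_eexp_poissonMeasure _ hc,
    ENNReal.coe_toNNReal hΛ]

/-- The fibres of `f` cut `S` into disjoint sets, whose counts are independent and Poisson. The
exponential of the integral is a product over these sets, so its mean factorises. Restricting to `S`
of finite intensity makes every count Poisson. -/
lemma lintegral_eexp_simpleFunc (hX : IsPoissonPointProcess P Λ X) (f : SimpleFunc E ℝ≥0∞)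
    (hf : ∀ x, f x ≠ ∞) {S : Set E} (hS : MeasurableSet S) (hΛ : Λ S ≠ ∞) :
    ∫⁻ ω, eexp (∫⁻ x in S, f x ∂(countingMeasure X ω)) ∂P =
      eexp (∫⁻ x in S, (eexp (f x) - 1) ∂Λ) := by
  classical
  let e := f.range.equivFin
  let c : Fin f.range.card → ℝ≥0∞ := fun j => (e.symm j : ℝ≥0∞)
  let A : Fin f.range.card → Set E := fun j => f ⁻¹' {c j} ∩ S
  have hA : ∀ j, MeasurableSet (A j) := fun j => (f.measurableSet_fiber _).inter hS
  have hΛA : ∀ j, Λ (A j) ≠ ∞ := fun j => measure_ne_top_of_subset Set.inter_subset_right hΛ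
  have hdisj : Pairwise fun i j => Disjoint (A i) (A j) := by
    intro i j hij
    refine Set.disjoint_left.2 fun x hx hy => hij ?_
    have : c i = c j := by rw [← show f x = c i from hx.1, ← show f x = c j from hy.1]
    exact e.symm.injective (Subtype.ext this)
  have hc : ∀ j, c j ≠ ∞ := fun j => by
    obtain ⟨x, hx⟩ := SimpleFunc.mem_range.1 (e.symm j).2
    rw [show c j = f x from hx.symm]
    exact hf x
  have hsum : ∀ (μ : Measure E) (φ : ℝ≥0∞ → ℝ≥0∞),
      ∫⁻ x in S, φ (f x) ∂μ = ∑ j, φ (c j) * μ (A j) := by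
    intro μ φ
    have h1 : ∫⁻ x in S, φ (f x) ∂μ = ∑ y ∈ f.range, φ y * μ (f ⁻¹' {y} ∩ S) := by
      rw [show (fun x => φ (f x)) = (f.map φ) from rfl, SimpleFunc.lintegral_eq_lintegral,
        SimpleFunc.map_lintegral]
      refine Finset.sum_congr rfl fun y _ => ?_
      rw [Measure.restrict_apply (f.measurableSet_fiber _)]
    rw [h1, ← Finset.sum_coe_sort, ← e.symm.sum_comp]
  have h2 := hX.indep_count _ A hA hdisj
  have h3 := h2.comp (fun j y => eexp (c j * y))
    fun j => measurable_eexp.comp (measurable_id.const_mul _)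
  calc ∫⁻ ω, eexp (∫⁻ x in S, f x ∂(countingMeasure X ω)) ∂P
      = ∫⁻ ω, ∏ j, eexp (c j * countingMeasure X ω (A j)) ∂P := by
        refine lintegral_congr fun ω => ?_
        rw [← eexp_sum, ← hsum _ (fun y => y)]
    _ = ∏ j, ∫⁻ ω, eexp (c j * countingMeasure X ω (A j)) ∂P :=
        lintegral_prod_eq_prod_lintegral_of_indepFun _ _ h3 fun j =>
          measurable_eexp.comp ((hX.measurable_count (hA j)).const_mul _)
    _ = _ := by
        rw [hsum Λ (fun y => eexp y - 1), eexp_sum]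
        exact Finset.prod_congr rfl fun j _ => hX.lintegral_eexp_mul_count (hA j) (hΛA j) (hc j)

/-- The probability generating functional of a Poisson point process. -/
theorem lintegral_eexp_tsum [SigmaFinite Λ] (hX : IsPoissonPointProcess P Λ X)
    {g : E → ℝ≥0∞} (hg : Measurable g) :
    ∫⁻ ω, eexp (∑' i, g (X i ω)) ∂P = eexp (∫⁻ x, (eexp (g x) - 1) ∂Λ) := by
  let f : ℕ → SimpleFunc E ℝ≥0∞ := SimpleFunc.eapprox g
  let S : ℕ → Set E := spanningSets Λ
  have hS : ∀ n, MeasurableSet (S n) := measurableSet_spanningSets Λ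
  have hSm : Monotone S := monotone_spanningSets Λ
  have hfm : ∀ x, Monotone fun n => f n x := fun x m n h => SimpleFunc.monotone_eapprox g h x
  -- Both sides of the formula are monotone limits of this kind: the left with the counting measure
  -- and `φ y = y`, the right with `Λ` and `φ y = e^y - 1`. The truncation to `S n` and the
  -- finite-valued `f n` supply what the simple function case requires.
  have key : ∀ (μ : Measure E) (φ : ℝ≥0∞ → ℝ≥0∞), Monotone φ → Continuous φ →
      (Monotone fun n => ∫⁻ x in S n, φ (f n x) ∂μ) ∧
      ⨆ n, ∫⁻ x in S n, φ (f n x) ∂μ = ∫⁻ x, φ (g x) ∂μ := by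
    intro μ φ hφ hφc
    have hmono : Monotone fun n => (S n).indicator fun x => φ (f n x) := by
      intro m n h x
      refine (Set.indicator_le_indicator_of_subset (hSm h) (fun _ => zero_le) x).trans ?_
      exact Set.indicator_le_indicator (hφ (hfm x h))
    have hmeas : ∀ n, Measurable ((S n).indicator fun x => φ (f n x)) := fun n =>
      (hφc.measurable.comp (f n).measurable).indicator (hS n)
    simp_rw [← lintegral_indicator (hS _)]
    refine ⟨fun m n h => lintegral_mono (hmono h), ?_⟩
    rw [← lintegral_iSup hmeas hmono]
    refine lintegral_congr fun x => ?_
    have ht : Filter.Tendsto (fun n => φ (f n x)) Filter.atTop (nhds (φ (g x))) := by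
      refine (hφc.tendsto _).comp ?_
      rw [← SimpleFunc.iSup_eapprox_apply hg x]
      exact tendsto_atTop_iSup (hfm x)
    refine tendsto_nhds_unique (tendsto_atTop_iSup fun m n h => hmono h x) (ht.congr' ?_)
    have hx : x ∈ ⋃ n, S n := by rw [iUnion_spanningSets]; trivial
    obtain ⟨n, hn⟩ := Set.mem_iUnion.1 hx
    filter_upwards [Filter.eventually_ge_atTop n] with m hm
    rw [Set.indicator_of_mem (hSm hm hn)]
  have hsub : Continuous fun y => eexp y - 1 :=
    (ENNReal.continuous_sub_right 1).comp continuous_eexp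
  have hΛ := key Λ (fun y => eexp y - 1)
    (fun a b h => tsub_le_tsub_right (eexp_mono h) 1) hsub
  have hN := fun ω => key (countingMeasure X ω) (fun y => y) monotone_id continuous_id
  calc ∫⁻ ω, eexp (∑' i, g (X i ω)) ∂P
      = ∫⁻ ω, ⨆ n, eexp (∫⁻ x in S n, f n x ∂(countingMeasure X ω)) ∂P := by
        refine lintegral_congr fun ω => ?_
        rw [← eexp_iSup (hN ω).1, (hN ω).2, lintegral_countingMeasure X ω hg]
    _ = ⨆ n, ∫⁻ ω, eexp (∫⁻ x in S n, f n x ∂(countingMeasure X ω)) ∂P := by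
        refine lintegral_iSup (fun n => measurable_eexp.comp ?_)
          fun m n h ω => eexp_mono ((hN ω).1 h)
        simp_rw [← lintegral_indicator (hS n)]
        have hm : Measurable ((S n).indicator (f n)) := (f n).measurable.indicator (hS n)
        simp_rw [lintegral_countingMeasure X _ hm]
        exact Measurable.tsum fun i => hm.comp (hX.measurable i)
    _ = ⨆ n, eexp (∫⁻ x in S n, (eexp (f n x) - 1) ∂Λ) := by
        refine iSup_congr fun n => hX.lintegral_eexp_simpleFunc (f n)
          (fun x => (SimpleFunc.eapprox_lt_top g n x).ne) (hS n)
          (measure_spanningSets_lt_top Λ n).ne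
    _ = _ := by rw [← eexp_iSup hΛ.1, hΛ.2]

end IsPoissonPointProcess

/-! ### Waiting time for the `n`-th success -/

open Classical in
/-- The number of successful slots among the first `k` ones. -/
def successCount (success : ℕ → Prop) (k : ℕ) : ℕ := ((Finset.range k).filter success).card

open Classical in
lemma successCount_succ (success : ℕ → Prop) (k : ℕ) :
    successCount success (k + 1) = successCount success k + if success k then 1 else 0 := by
  rw [successCount, successCount, Finset.range_add_one, Finset.filter_insert]
  split_ifs with h
  · rw [Finset.card_insert_of_notMem (by simp)]
  · simp

lemma successCount_zero (success : ℕ → Prop) : successCount success 0 = 0 := by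
  simp [successCount]

lemma monotone_successCount (success : ℕ → Prop) : Monotone (successCount success) :=
  monotone_nat_of_le_succ fun k => by rw [successCount_succ]; exact Nat.le_add_right _ _

-- The waiting time is the sum over `k` of the indicators that it exceeds `k`, which happens exactly
-- when the first `k` slots contain fewer than `n` successes. For `n = 0` the two sides would be `1`
-- and `0`.
open Classical in
lemma slotsUntil_eq_tsum {n : ℕ} (hn : 1 ≤ n) (success : ℕ → Prop) :
    slotsUntil n success = ∑' k, if successCount success k < n then 1 else 0 := by
  change (⨅ (k : ℕ) (_ : n ≤ successCount success (k + 1)), ((k : ℝ≥0∞) + 1)) = _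
  by_cases hex : ∃ k, n ≤ successCount success (k + 1)
  · have hlt : ∀ k, successCount success k < n ↔ k ∈ Finset.range (Nat.find hex + 1) := by
      intro k
      rw [Finset.mem_range]
      constructor
      · intro hk
        by_contra! h
        exact absurd ((Nat.find_spec hex).trans (monotone_successCount success h)) (not_le.2 hk)
      · intro hk
        rcases k with - | k
        · rw [successCount_zero]; omega
        · exact not_le.1 (Nat.find_min hex (by omega))
    rw [tsum_eq_sum (s := Finset.range (Nat.find hex + 1))
      fun k hk => if_neg (mt (hlt k).1 hk), Finset.sum_congr rfl fun k hk => if_pos ((hlt k).2 hk)]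
    simp only [Finset.sum_const, Finset.card_range, nsmul_eq_mul, mul_one, Nat.cast_add,
      Nat.cast_one]
    refine le_antisymm (iInf₂_le_of_le _ (Nat.find_spec hex) le_rfl) (le_iInf₂ fun k hk => ?_)
    gcongr
    exact Nat.find_min' hex hk
  · push Not at hex
    have h1 : ∀ k, successCount success k < n := fun k =>
      (monotone_successCount success k.le_succ).trans_lt (hex k)
    simp [h1, fun k => not_le.2 (hex k)]

/-- If each slot is successful with probability `q`, independently of the past, then `a k j`, the
probability of `j` successes in `k` slots, satisfies the recursion assumed here. -/
lemma tsum_sum_binomial {q r : ℝ≥0∞} (hqr : r + q = 1) (a : ℕ → ℕ → ℝ≥0∞) (h00 : a 0 0 = 1)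
    (h0 : ∀ j, a 0 (j + 1) = 0) (hs0 : ∀ k, a (k + 1) 0 = r * a k 0)
    (hs : ∀ k j, a (k + 1) (j + 1) = r * a k (j + 1) + q * a k j) {n : ℕ} (hn : 1 ≤ n) :
    ∑' k, ∑ j ∈ Finset.range n, a k j = n * q⁻¹ := by
  have hr : r ≠ ∞ := fun h => by simp [h] at hqr
  have hq : q ≠ ∞ := fun h => by simp [h] at hqr
  have hr1 : 1 - r = q := by rw [← hqr]; exact ENNReal.add_sub_cancel_left hr
  have hV0 : ∑' k, a k 0 = q⁻¹ := by
    have : ∀ k, a k 0 = r ^ k := by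
      intro k
      induction k with
      | zero => simpa using h00
      | succ k ih => rw [hs0, ih, pow_succ']
    simp_rw [this, ENNReal.tsum_geometric, hr1]
  rw [Summable.tsum_finsetSum fun _ _ => ENNReal.summable]
  -- If success is impossible, the term `j = 0` alone is already infinite.
  rcases eq_or_ne q 0 with rfl | hq0
  · have hle : ∑' k, a k 0 ≤ ∑ j ∈ Finset.range n, ∑' k, a k j :=
      Finset.single_le_sum (f := fun j => ∑' k, a k j) (fun _ _ => zero_le)
        (Finset.mem_range.2 hn)
    rw [hV0, ENNReal.inv_zero, top_le_iff] at hle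
    rw [hle, ENNReal.inv_zero, ENNReal.mul_top (by simp; omega)]
  · have hV : ∀ j, ∑' k, a k j = q⁻¹ := by
      intro j
      induction j with
      | zero => exact hV0
      | succ j ih =>
        have hqq : q * q⁻¹ = 1 := ENNReal.mul_inv_cancel hq0 hq
        -- Summing the recursion over `k` gives `V = r V + 1`, from which `r V` can be cancelled
        -- only if `V` is finite. The bound on partial sums, by the same recursion, provides this.
        have hbound : ∀ N, ∑ k ∈ Finset.range N, a k (j + 1) ≤ q⁻¹ := by
          intro N
          induction N with
          | zero => simp
          | succ N ihN =>
            rw [Finset.sum_range_succ', h0, add_zero]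
            simp_rw [hs]
            rw [Finset.sum_add_distrib, ← Finset.mul_sum, ← Finset.mul_sum]
            calc _ ≤ r * q⁻¹ + q * q⁻¹ := by
                  gcongr
                  rw [← ih]
                  exact ENNReal.sum_le_tsum _
              _ = q⁻¹ := by rw [← add_mul, hqr, one_mul]
        have hfin : ∑' k, a k (j + 1) ≠ ∞ := by
          refine ne_top_of_le_ne_top (ENNReal.inv_ne_top.2 hq0) ?_
          rw [ENNReal.tsum_eq_iSup_nat]
          exact iSup_le hbound
        have hrec : ∑' k, a k (j + 1) = r * ∑' k, a k (j + 1) + 1 := by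
          conv_lhs => rw [tsum_eq_zero_add' ENNReal.summable, h0, zero_add]
          simp_rw [hs]
          rw [ENNReal.tsum_add, ENNReal.tsum_mul_left, ENNReal.tsum_mul_left, ih, hqq]
        set V := ∑' k, a k (j + 1) with hVdef
        have h2 : r * V + q * V = r * V + 1 := by rw [← add_mul, hqr, one_mul, ← hrec]
        have h3 : q * V = 1 := (ENNReal.add_right_inj (ENNReal.mul_ne_top hr hfin)).1 h2
        exact ENNReal.eq_inv_of_mul_eq_one_left (by rwa [mul_comm])
    simp [hV]

lemma successCount_congr {s t : ℕ → Prop} {k : ℕ} (h : ∀ i < k, (s i ↔ t i)) :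
    successCount s k = successCount t k := by
  classical
  unfold successCount
  congr 1
  simpa using Finset.filter_congr fun i hi => h i (Finset.mem_range.1 hi)

lemma measurable_successCount {Ω : Type*} [MeasurableSpace Ω] {E : ℕ → Set Ω}
    (hE : ∀ k, MeasurableSet (E k)) (k : ℕ) : Measurable fun ω => successCount (ω ∈ E ·) k := by
  classical
  induction k with
  | zero => simp_rw [successCount_zero]; exact measurable_const
  | succ k ih =>
    simp_rw [successCount_succ]
    exact ih.add (Measurable.ite (hE k) measurable_const measurable_const)

lemma measurable_slotsUntil {Ω : Type*} [MeasurableSpace Ω] {E : ℕ → Set Ω}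
    (hE : ∀ k, MeasurableSet (E k)) {n : ℕ} (hn : 1 ≤ n) :
    Measurable fun ω => slotsUntil n (ω ∈ E ·) := by
  classical
  simp_rw [slotsUntil_eq_tsum hn]
  exact Measurable.tsum fun k => Measurable.ite (measurable_successCount hE k measurableSet_Iio)
    measurable_const measurable_const

/-- The mean waiting time for the `n`-th success. -/
lemma lintegral_slotsUntil {Ω : Type*} [MeasurableSpace Ω] {P : Measure Ω} [IsProbabilityMeasure P]
    {E : ℕ → Set Ω} (hE : ∀ k, MeasurableSet (E k)) {q : ℝ≥0∞} (hq : ∀ k, P (E k) = q)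
    (hind : ∀ k j, P ({ω | successCount (ω ∈ E ·) k = j} ∩ E k) =
      P {ω | successCount (ω ∈ E ·) k = j} * P (E k)) {n : ℕ} (hn : 1 ≤ n) :
    ∫⁻ ω, slotsUntil n (ω ∈ E ·) ∂P = n * q⁻¹ := by
  classical
  have hmeas := measurable_successCount hE
  have hms : ∀ k j, MeasurableSet {ω | successCount (ω ∈ E ·) k = j} := fun k j =>
    hmeas k (measurableSet_singleton j)
  have hq1 : q ≤ 1 := hq 0 ▸ prob_le_one
  -- The recursion also needs the failure probabilities; they follow from independence of the
  -- current slot and the number of past successes by subtraction.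
  have hcompl : ∀ k j, P ({ω | successCount (ω ∈ E ·) k = j} ∩ (E k)ᶜ) =
      (1 - q) * P {ω | successCount (ω ∈ E ·) k = j} := by
    intro k j
    rw [← Set.sdiff_eq]
    have h := measure_inter_add_sdiff (μ := P) {ω | successCount (ω ∈ E ·) k = j} (hE k)
    rw [hind, hq] at h
    rw [ENNReal.sub_mul fun _ _ => measure_ne_top _ _, one_mul, mul_comm q]
    refine ENNReal.eq_sub_of_add_eq ?_ (by rw [add_comm]; exact h)
    exact ENNReal.mul_ne_top (measure_ne_top _ _) (ne_top_of_le_ne_top ENNReal.one_ne_top hq1)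
  rw [← tsum_sum_binomial (tsub_add_cancel_of_le hq1)
    (fun k j => P {ω | successCount (ω ∈ E ·) k = j}) (by simp [successCount_zero])
    (by simp [successCount_zero]) ?_ ?_ hn]
  · simp_rw [slotsUntil_eq_tsum hn]
    rw [lintegral_tsum]
    · refine tsum_congr fun k => ?_
      have : (fun ω => if successCount (ω ∈ E ·) k < n then (1 : ℝ≥0∞) else 0) =
          {ω | successCount (ω ∈ E ·) k < n}.indicator 1 := by
        ext ω; simp [Set.indicator_apply]
      rw [this]
      refine (lintegral_indicator_one (hmeas k measurableSet_Iio)).trans ?_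
      rw [← measure_biUnion_finset ?_ fun j _ => hms k j]
      · congr 1
        ext ω; simp
      · intro i _ j _ hij
        refine Set.disjoint_left.2 fun ω h1 h2 => hij ?_
        rw [← show _ = i from h1, ← show _ = j from h2]
    · intro k
      exact (Measurable.ite (hmeas k measurableSet_Iio) measurable_const
        measurable_const).aemeasurable
  · intro k
    rw [← hcompl]
    congr 1
    ext ω
    by_cases h : ω ∈ E k <;> simp [successCount_succ, h]
  · intro k j
    rw [← hcompl, mul_comm q, ← hq k, ← hind,
      ← measure_inter_add_sdiff (μ := P) {ω | successCount (ω ∈ E ·) (k + 1) = j + 1} (hE k),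
      add_comm]
    congr 2 <;> ext ω <;> by_cases h : ω ∈ E k <;> simp [successCount_succ, h]

/-! ### Independence of families and Fubini -/

section Independence

variable {Ω ι : Type*} [MeasurableSpace Ω] {P : Measure Ω}

/-- Two independent families of independent random variables can be paired. -/
lemma ProbabilityTheory.iIndepFun.prodMk_of_indepFun {α β : ι → Type*}
    [∀ i, MeasurableSpace (α i)] [∀ i, MeasurableSpace (β i)] {f : ∀ i, Ω → α i}
    {g : ∀ i, Ω → β i} (hf : ∀ i, Measurable (f i)) (hg : ∀ i, Measurable (g i))
    (hfi : iIndepFun f P) (hgi : iIndepFun g P)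
    (hfg : IndepFun (fun ω i => f i ω) (fun ω i => g i ω) P) :
    iIndepFun (fun i ω => (f i ω, g i ω)) P := by
  classical
  have := hfi.isProbabilityMeasure
  rw [iIndepFun_iff_iIndep]
  -- Independence is checked on the π-system of preimages of rectangles, which generates the
  -- σ-algebra of each pair.
  refine iIndepSets.iIndep (fun i => ((hf i).prodMk (hg i)).comap_le)
    (fun i => {s | ∃ A B, MeasurableSet A ∧ MeasurableSet B ∧ s = f i ⁻¹' A ∩ g i ⁻¹' B}) ?_ ?_ ?_
  · rintro i _ ⟨A, B, hA, hB, rfl⟩ _ ⟨A', B', hA', hB', rfl⟩ -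
    exact ⟨A ∩ A', B ∩ B', hA.inter hA', hB.inter hB', by ext; simp; tauto⟩
  · intro i
    rw [← generateFrom_prod, MeasurableSpace.comap_generateFrom]
    congr 1
    ext s
    simp only [Set.mem_image, Set.mem_image2, Set.mem_ofPred_eq]
    constructor
    · rintro ⟨_, ⟨A, hA, B, hB, rfl⟩, rfl⟩
      exact ⟨A, B, hA, hB, rfl⟩
    · rintro ⟨A, B, hA, hB, rfl⟩
      exact ⟨A ×ˢ B, ⟨A, hA, B, hB, rfl⟩, rfl⟩
  · rw [iIndepSets_iff]
    intro s F hF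
    choose! A B hA hB hAB using hF
    have h1 : ⋂ i ∈ s, F i = (fun ω i => f i ω) ⁻¹' ((s : Set ι).pi A) ∩
        (fun ω i => g i ω) ⁻¹' ((s : Set ι).pi B) := by
      ext ω
      simp only [Set.mem_iInter, Set.mem_inter_iff, Set.mem_preimage, Set.mem_pi, Finset.mem_coe]
      rw [← forall₂_and]
      refine forall₂_congr fun i hi => ?_
      rw [hAB i hi]; rfl
    have h2 : (fun ω i => f i ω) ⁻¹' ((s : Set ι).pi A) = ⋂ i ∈ s, f i ⁻¹' A i := by
      ext; simp
    have h3 : (fun ω i => g i ω) ⁻¹' ((s : Set ι).pi B) = ⋂ i ∈ s, g i ⁻¹' B i := by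
      ext; simp
    rw [h1, hfg.measure_inter_preimage_eq_mul _ _
        (MeasurableSet.pi s.countable_toSet fun i hi => hA i hi)
        (MeasurableSet.pi s.countable_toSet fun i hi => hB i hi), h2, h3,
      hfi.measure_inter_preimage_eq_mul s (fun i hi => hA i hi),
      hgi.measure_inter_preimage_eq_mul s (fun i hi => hB i hi), ← Finset.prod_mul_distrib]
    refine Finset.prod_congr rfl fun i hi => ?_
    rw [hAB i hi]
    have hfgi : IndepFun (f i) (g i) P := hfg.comp (measurable_pi_apply i) (measurable_pi_apply i)
    rw [hfgi.measure_inter_preimage_eq_mul _ _ (hA i hi) (hB i hi)]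

/-- Subfamilies of independent random variables with disjoint index sets are independent. -/
lemma ProbabilityTheory.iIndepFun.indepFun_restrict_of_disjoint {β : ι → Type*}
    [∀ i, MeasurableSpace (β i)] {f : ∀ i, Ω → β i} (hf : ∀ i, Measurable (f i))
    (hfi : iIndepFun f P) {S T : Set ι} (hST : Disjoint S T) :
    IndepFun (fun ω (i : S) => f i ω) (fun ω (i : T) => f i ω) P := by
  have h := indep_iSup_of_disjoint (fun i => (hf i).comap_le) hfi.iIndep hST
  have key : ∀ U : Set ι, MeasurableSpace.comap (fun ω (i : U) => f i ω) MeasurableSpace.pi ≤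
      ⨆ i ∈ U, MeasurableSpace.comap (f i) inferInstance := by
    intro U
    rw [MeasurableSpace.pi, MeasurableSpace.comap_iSup]
    refine iSup_le fun i => ?_
    rw [MeasurableSpace.comap_comp]
    exact le_iSup₂ (f := fun i (_ : i ∈ U) => MeasurableSpace.comap (f i) inferInstance) i.1 i.2
  rw [IndepFun_iff_Indep]
  exact indep_of_indep_of_le_left (indep_of_indep_of_le_right h (key T)) (key S)

/-- Fubini's theorem for independent random variables. -/
lemma ProbabilityTheory.IndepFun.lintegral_comp_prodMk [IsProbabilityMeasure P] {α β : Type*}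
    [MeasurableSpace α] [MeasurableSpace β] {f : Ω → α} {g : Ω → β} (h : IndepFun f g P)
    (hf : Measurable f) (hg : Measurable g) {F : α → β → ℝ≥0∞}
    (hF : Measurable (Function.uncurry F)) :
    ∫⁻ ω, F (f ω) (g ω) ∂P = ∫⁻ ω, ∫⁻ ω', F (f ω) (g ω') ∂P ∂P := by
  have := Measure.isProbabilityMeasure_map (μ := P) hg.aemeasurable
  calc ∫⁻ ω, F (f ω) (g ω) ∂P = ∫⁻ z, Function.uncurry F z ∂(P.map fun ω => (f ω, g ω)) := by
        rw [lintegral_map hF (hf.prodMk hg)]; rfl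
    _ = ∫⁻ x, ∫⁻ y, F x y ∂(P.map g) ∂(P.map f) := by
        rw [(indepFun_iff_map_prod_eq_prod_map_map hf.aemeasurable hg.aemeasurable).1 h,
          lintegral_prod _ hF.aemeasurable]; rfl
    _ = _ := by
        rw [lintegral_map hF.lintegral_prod_right hf]
        refine lintegral_congr fun ω => ?_
        exact lintegral_map (hF.comp measurable_prodMk_left) hg

end Independence

/-! ### The exponential distribution -/

section Exponential

/-- Needed for infinite path loss: by `0 * ∞ = 0`, a nonpositive fading value would contribute `1`
instead of `0` to the Laplace transform. -/
lemma ae_pos_expMeasure : ∀ᵐ x ∂(expMeasure 1), 0 < x := by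
  have h := cdf_expMeasure_eq one_pos 0
  have := isProbabilityMeasure_expMeasure one_pos
  rw [cdf_eq_real] at h
  simp only [le_refl, if_true, mul_zero, neg_zero, Real.exp_zero, sub_self] at h
  rw [ae_iff]
  simp only [not_lt]
  exact (measureReal_eq_zero_iff).1 h

/-- The tail of the exponential distribution. -/
lemma expMeasure_ofReal_gt (v : ℝ≥0∞) :
    expMeasure 1 {x | v < ENNReal.ofReal x} = (eexp v)⁻¹ := by
  have := isProbabilityMeasure_expMeasure one_pos
  induction v with
  | top => simp
  | coe v =>
    have h := cdf_expMeasure_eq one_pos v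
    rw [cdf_eq_real, if_pos v.coe_nonneg] at h
    have hset : {x : ℝ | (v : ℝ≥0∞) < ENNReal.ofReal x} = (Set.Iic (v : ℝ))ᶜ := by
      ext x
      simp only [Set.mem_ofPred_eq, Set.mem_compl_iff, Set.mem_Iic, not_le]
      rw [← ENNReal.ofReal_coe_nnreal, ENNReal.ofReal_lt_ofReal_iff']
      exact ⟨fun h => h.1, fun h => ⟨h, v.coe_nonneg.trans_lt h⟩⟩
    rw [hset, ← ENNReal.ofReal_coe_nnreal, eexp_ofReal v.coe_nonneg,
      ← ENNReal.ofReal_inv_of_pos (Real.exp_pos _), ← Real.exp_neg, ← ofReal_measureReal,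
      measureReal_compl measurableSet_Iic, h]
    simp

/-- The Laplace transform of the exponential distribution. -/
lemma lintegral_eexp_inv_expMeasure (u : ℝ≥0∞) :
    ∫⁻ x, (eexp (ENNReal.ofReal x * u))⁻¹ ∂(expMeasure 1) = (1 + u)⁻¹ := by
  induction u with
  | top =>
    rw [lintegral_congr_ae (g := 0) ?_]
    · simp
    · filter_upwards [ae_pos_expMeasure] with x hx
      rw [ENNReal.mul_top (by simpa using hx)]
      simp
  | coe u =>
    have hu : (0 : ℝ) < 1 + u := by positivity
    have hm : Measurable fun x : ℝ => (eexp (ENNReal.ofReal x * u))⁻¹ := by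
      exact (measurable_eexp.comp (ENNReal.measurable_ofReal.mul_const _)).inv
    have hone := lintegral_exponentialPDF_eq_one hu
    have hd : Measurable (gammaPDF 1 1) := (measurable_gammaPDFReal 1 1).ennreal_ofReal
    rw [expMeasure, gammaMeasure, lintegral_withDensity_eq_lintegral_mul _ hd hm]
    have hcoe : ((1 : ℝ≥0∞) + u) = ENNReal.ofReal (1 + u) := by
      rw [ENNReal.ofReal_add zero_le_one u.coe_nonneg]; simp
    rw [hcoe]
    refine ENNReal.eq_inv_of_mul_eq_one_left ?_
    rw [← lintegral_mul_const' _ _ ENNReal.ofReal_ne_top, ← hone]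
    refine lintegral_congr fun x => ?_
    rcases lt_or_ge x 0 with hx | hx
    · simp [gammaPDF_of_neg hx, exponentialPDF_of_neg hx]
    · have h1 : gammaPDF 1 1 x = ENNReal.ofReal (Real.exp (-x)) := by
        rw [gammaPDF_of_nonneg hx]; simp
      have h2 : (eexp (ENNReal.ofReal x * u))⁻¹ = ENNReal.ofReal (Real.exp (-(x * u))) := by
        rw [← ENNReal.ofReal_coe_nnreal, ← ENNReal.ofReal_mul hx,
          eexp_ofReal (by positivity), ← ENNReal.ofReal_inv_of_pos (Real.exp_pos _), Real.exp_neg]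
      rw [Pi.mul_apply, h1, h2, exponentialPDF_of_nonneg hx,
        ← ENNReal.ofReal_mul (Real.exp_pos _).le, ← Real.exp_add,
        ← ENNReal.ofReal_mul (Real.exp_pos _).le]
      congr 1
      rw [mul_comm]; ring_nf

end Exponential

/-! ### Success probability of a slot for given locations -/

/-- The Laplace transform at `u` of an exponential variable that is set to `0` with probability
`1 - p`. -/
def thinnedLaplace (p u : ℝ≥0∞) : ℝ≥0∞ := (1 - p) + p * (1 + u)⁻¹

lemma thinnedLaplace_le_one {p : ℝ≥0∞} (hp : p ≤ 1) (u : ℝ≥0∞) : thinnedLaplace p u ≤ 1 := by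
  calc thinnedLaplace p u ≤ (1 - p) + p * 1 := by
        unfold thinnedLaplace
        gcongr
        exact ENNReal.inv_le_one.2 le_self_add
    _ = 1 := by rw [mul_one, tsub_add_cancel_of_le hp]

/-- The cumulant belonging to `thinnedLaplace`. -/
def thinnedCumulant (p u : ℝ≥0∞) : ℝ≥0∞ := elog (thinnedLaplace p u)⁻¹

lemma eexp_thinnedCumulant {p : ℝ≥0∞} (hp : p ≤ 1) (u : ℝ≥0∞) :
    eexp (thinnedCumulant p u) = (thinnedLaplace p u)⁻¹ :=
  eexp_elog (ENNReal.one_le_inv.2 (thinnedLaplace_le_one hp u))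

lemma measurable_thinnedCumulant (p : ℝ≥0∞) : Measurable (thinnedCumulant p) :=
  measurable_elog.comp
    ((((measurable_id.const_add 1).inv.const_mul p).const_add (1 - p)).inv)

open Classical in
/-- The contribution of a transmitter with fading and MAC state `z` and path loss `u`, if it
interferes whenever its MAC state is in `T`. -/
def received {M : Type*} (T : Set M) (u : ℝ≥0∞) (z : ℝ × M) : ℝ≥0∞ :=
  if z.2 ∈ T then ENNReal.ofReal z.1 * u else 0

section Interference

variable {Ω M : Type*} [MeasurableSpace Ω] [MeasurableSpace M] {P : Measure Ω}
  [IsProbabilityMeasure P]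

lemma measurable_received {T : Set M} (hT : MeasurableSet T) (u : ℝ≥0∞) :
    Measurable (received T u) :=
  Measurable.ite (measurable_snd hT) ((ENNReal.measurable_ofReal.comp measurable_fst).mul_const u)
    measurable_const

lemma lintegral_eexp_inv_received {T : Set M} (hT : MeasurableSet T) {p : ℝ≥0∞}
    {Z : Ω → ℝ × M} (hZ : Measurable Z) (hlaw : HasLaw (fun ω => (Z ω).1) (expMeasure 1) P)
    (hind : IndepFun (fun ω => (Z ω).1) (fun ω => (Z ω).2) P)
    (hp : P {ω | (Z ω).2 ∈ T} = p) (u : ℝ≥0∞) :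
    ∫⁻ ω, (eexp (received T u (Z ω)))⁻¹ ∂P = thinnedLaplace p u := by
  have hm : Measurable fun x : ℝ => (eexp (ENNReal.ofReal x * u))⁻¹ :=
    (measurable_eexp.comp (ENNReal.measurable_ofReal.mul_const _)).inv
  have hsplit : ∀ ω, (eexp (received T u (Z ω)))⁻¹ =
      Tᶜ.indicator 1 (Z ω).2 + (eexp (ENNReal.ofReal (Z ω).1 * u))⁻¹ * T.indicator 1 (Z ω).2 := by
    intro ω
    by_cases h : (Z ω).2 ∈ T <;> simp [received, h]
  have hpre : MeasurableSet {ω | (Z ω).2 ∈ T} := hZ.snd hT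
  have h1 : ∫⁻ ω, T.indicator 1 (Z ω).2 ∂P = p := by
    rw [← hp]; exact lintegral_indicator_one hpre
  have h2 : ∫⁻ ω, Tᶜ.indicator 1 (Z ω).2 ∂P = 1 - p := by
    rw [← hp, ← prob_compl_eq_one_sub hpre]; exact lintegral_indicator_one hpre.compl
  have hI : Measurable (T.indicator (1 : M → ℝ≥0∞)) := measurable_one.indicator hT
  have hIc : Measurable (Tᶜ.indicator (1 : M → ℝ≥0∞)) := measurable_one.indicator hT.compl
  have h3 : ∫⁻ ω, (eexp (ENNReal.ofReal (Z ω).1 * u))⁻¹ * T.indicator 1 (Z ω).2 ∂P =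
      (∫⁻ ω, (eexp (ENNReal.ofReal (Z ω).1 * u))⁻¹ ∂P) * ∫⁻ ω, T.indicator 1 (Z ω).2 ∂P :=
    lintegral_mul_eq_lintegral_mul_lintegral_of_indepFun'' (hm.comp hZ.fst).aemeasurable
      (hI.comp hZ.snd).aemeasurable (hind.comp hm hI)
  simp_rw [hsplit]
  rw [lintegral_add_left (f := fun ω => Tᶜ.indicator 1 (Z ω).2) (hIc.comp hZ.snd), h2, h3, h1,
    hlaw.lintegral_comp (f := fun x => (eexp (ENNReal.ofReal x * u))⁻¹) hm.aemeasurable,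
    lintegral_eexp_inv_expMeasure, thinnedLaplace, mul_comm p]

/-- The Laplace transform of the interference for given locations. -/
lemma lintegral_eexp_inv_tsum_received {T : Set M} (hT : MeasurableSet T) {p : ℝ≥0∞}
    {Z : ℕ → Ω → ℝ × M} (hZ : ∀ i, Measurable (Z i)) (hZi : iIndepFun Z P)
    (hlaw : ∀ i, HasLaw (fun ω => (Z i ω).1) (expMeasure 1) P)
    (hind : ∀ i, IndepFun (fun ω => (Z i ω).1) (fun ω => (Z i ω).2) P)
    (hp : ∀ i, P {ω | (Z i ω).2 ∈ T} = p) (u : ℕ → ℝ≥0∞) :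
    ∫⁻ ω, (eexp (∑' i, received T (u i) (Z i ω)))⁻¹ ∂P =
      (eexp (∑' i, thinnedCumulant p (u i)))⁻¹ := by
  have hp1 : p ≤ 1 := hp 0 ▸ prob_le_one
  have hcont : Continuous fun y => (eexp y)⁻¹ := continuous_eexp.inv
  have hmV : ∀ i, Measurable fun ω => received T (u i) (Z i ω) := fun i =>
    (measurable_received hT _).comp (hZ i)
  have hinv : ∀ (n : ℕ) (v : ℕ → ℝ≥0∞), (eexp (∑ i ∈ Finset.range n, v i))⁻¹ =
      ∏ i ∈ Finset.range n, (eexp (v i))⁻¹ := by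
    intro n v
    induction n with
    | zero => simp
    | succ n ih => rw [Finset.sum_range_succ, Finset.prod_range_succ, eexp_inv_add, ih]
  have hfin : ∀ n, ∫⁻ ω, (eexp (∑ i ∈ Finset.range n, received T (u i) (Z i ω)))⁻¹ ∂P =
      (eexp (∑ i ∈ Finset.range n, thinnedCumulant p (u i)))⁻¹ := by
    intro n
    simp_rw [hinv]
    rw [lintegral_prod_eq_prod_lintegral_of_indepFun (Finset.range n)
      (fun i ω => (eexp (received T (u i) (Z i ω)))⁻¹)
      (hZi.comp (fun i z => (eexp (received T (u i) z))⁻¹)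
        fun i => (measurable_eexp.comp (measurable_received hT _)).inv)
      fun i => (measurable_eexp.comp (hmV i)).inv]
    refine Finset.prod_congr rfl fun i _ => ?_
    rw [lintegral_eexp_inv_received hT (hZ i) (hlaw i) (hind i) (hp i),
      eexp_thinnedCumulant hp1, inv_inv]
  -- Passage from finitely many interferers to all of them, with dominating function `1`. Infinite
  -- total interference is allowed, as `y ↦ (eexp y)⁻¹` is continuous up to `∞`.
  refine tendsto_nhds_unique (f := fun n : ℕ => ∫⁻ ω,
    (eexp (∑ i ∈ Finset.range n, received T (u i) (Z i ω)))⁻¹ ∂P) (l := Filter.atTop) ?_ ?_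
  · refine tendsto_lintegral_of_dominated_convergence (fun _ => 1) (fun n => ?_) (fun n => ?_)
      (by simp) (.of_forall fun ω => ?_)
    · exact (measurable_eexp.comp (Finset.measurable_fun_sum _ fun i _ => hmV i)).inv
    · exact .of_forall fun ω => ENNReal.inv_le_one.2 (one_le_eexp _)
    · exact (hcont.tendsto _).comp ENNReal.summable.hasSum.tendsto_sum_nat
  · simp_rw [hfin]
    exact (hcont.tendsto _).comp ENNReal.summable.hasSum.tendsto_sum_nat

/-- The event that a link with fading and MAC state `y none` is active and overcomes the noise
`ν` and the interference of the transmitters with states `y (some i)` and path losses `u i`. -/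
def linkSuccess (T : Set M) (ν : ℝ≥0∞) (u : ℕ → ℝ≥0∞) : Set (Node → ℝ × M) :=
  {y | (y none).2 ∈ T ∧ ν + ∑' i, received T (u i) (y (some i)) < ENNReal.ofReal (y none).1}

/-- The interference `J` involves only the interferers, so it is independent of the state of the
desired transmitter. For fixed `J` the success probability is `p e^(-(ν + J))`, by the exponential
tail; averaging over `J` leaves its Laplace transform. -/
lemma measure_linkSuccess {T : Set M} (hT : MeasurableSet T) {p : ℝ≥0∞}
    {Z : Node → Ω → ℝ × M} (hZ : ∀ i, Measurable (Z i)) (hZi : iIndepFun Z P)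
    (hlaw : ∀ i, HasLaw (fun ω => (Z i ω).1) (expMeasure 1) P)
    (hind : ∀ i, IndepFun (fun ω => (Z i ω).1) (fun ω => (Z i ω).2) P)
    (hp : ∀ i, P {ω | (Z i ω).2 ∈ T} = p) (ν : ℝ≥0∞) (u : ℕ → ℝ≥0∞) :
    P {ω | (fun x => Z x ω) ∈ linkSuccess T ν u} =
      p * (eexp ν)⁻¹ * (eexp (∑' i, thinnedCumulant p (u i)))⁻¹ := by
  classical
  let J : Ω → ℝ≥0∞ := fun ω => ∑' i, received T (u i) (Z (some i) ω)
  have hJ : Measurable J := Measurable.tsum fun i =>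
    (measurable_received hT _).comp (hZ (some i))
  have hindep : IndepFun J (Z none) P := by
    have h := hZi.indepFun_restrict_of_disjoint hZ (S := Set.range some) (T := {none}) (by simp)
    have hm : Measurable fun y : (Set.range (some : ℕ → Node)) → ℝ × M =>
        ∑' i : ℕ, received T (u i) (y ⟨some i, i, rfl⟩) :=
      Measurable.tsum fun i => (measurable_received hT _).comp (measurable_pi_apply _)
    exact h.comp hm (measurable_pi_apply (⟨none, rfl⟩ : ({none} : Set Node)))
  let F : ℝ≥0∞ → ℝ × M → ℝ≥0∞ := fun j z =>
    if z.2 ∈ T ∧ ν + j < ENNReal.ofReal z.1 then 1 else 0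
  have hFset : MeasurableSet {z : ℝ≥0∞ × ℝ × M | z.2.2 ∈ T ∧ ν + z.1 < ENNReal.ofReal z.2.1} :=
    (measurable_snd.snd hT).inter
      (measurableSet_lt (measurable_fst.const_add ν) measurable_snd.fst.ennreal_ofReal)
  have hF : Measurable (Function.uncurry F) :=
    Measurable.ite hFset measurable_const measurable_const
  have h1 : P {ω | (fun x => Z x ω) ∈ linkSuccess T ν u} = ∫⁻ ω, F (J ω) (Z none ω) ∂P := by
    refine (lintegral_indicator_one (hFset.preimage (hJ.prodMk (hZ none)))).symm.trans ?_
    refine lintegral_congr fun ω => ?_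
    simp [F, Set.indicator_apply]
  have h2 : ∀ j, ∫⁻ ω, F j (Z none ω) ∂P = (eexp ν)⁻¹ * (eexp j)⁻¹ * p := by
    intro j
    have hA : MeasurableSet {x : ℝ | ν + j < ENNReal.ofReal x} :=
      measurableSet_lt measurable_const ENNReal.measurable_ofReal
    rw [← eexp_inv_add, ← expMeasure_ofReal_gt, ← (hlaw none).measure_eq hA, ← hp none]
    refine Eq.trans ?_ ((hind none).measure_inter_preimage_eq_mul _ _ hA hT)
    rw [← lintegral_indicator_one (((hZ none).fst hA).inter ((hZ none).snd hT))]
    refine lintegral_congr fun ω => ?_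
    simp [F, Set.indicator_apply, and_comm]
  rw [h1, hindep.lintegral_comp_prodMk hJ (hZ none) hF]
  simp_rw [h2]
  have hmJ : Measurable fun ω => (eexp (J ω))⁻¹ := (measurable_eexp.comp hJ).inv
  rw [lintegral_mul_const _ (hmJ.const_mul _), lintegral_const_mul _ hmJ,
    lintegral_eexp_inv_tsum_received hT (fun i => hZ (some i))
      (hZi.precomp (Option.some_injective _)) (fun i => hlaw _) (fun i => hind _) (fun i => hp _)]
  ring

end Interference

/-! ### The path loss integral over `ℝ^d` -/

section PathLossIntegral

lemma lintegral_rpow_mul_exp_neg_mul {a t : ℝ} (ha : 0 < a) (ht : 0 < t) :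
    ∫⁻ y in Set.Ioi (0 : ℝ), ENNReal.ofReal (y ^ (a - 1) * Real.exp (-(t * y))) =
      ENNReal.ofReal ((1 / t) ^ a * Real.Gamma a) := by
  have h := Real.integral_rpow_mul_exp_neg_mul_Ioi ha ht
  have hpos : 0 < (1 / t) ^ a * Real.Gamma a :=
    mul_pos (Real.rpow_pos_of_pos (by positivity) _) (Real.Gamma_pos_of_pos ha)
  rw [← h, ofReal_integral_eq_lintegral_ofReal]
  -- A nonintegrable function has Bochner integral `0`, so the positive value already forces
  -- integrability.
  · exact Integrable.of_integral_ne_zero (h ▸ hpos.ne')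
  · filter_upwards [ae_restrict_mem measurableSet_Ioi] with y hy
    exact mul_nonneg (Real.rpow_nonneg (le_of_lt hy) _) (Real.exp_pos _).le

variable {d : ℕ}

lemma unitBallVolume_pos (d : ℕ) : 0 < LinkParams.unitBallVolume d :=
  ENNReal.toReal_pos (Metric.measure_ball_pos _ _ one_pos).ne' measure_ball_lt_top.ne

lemma integral_exp_neg_norm_rpow {α : ℝ} (hα : 0 < α) :
    ∫ x : EuclideanSpace ℝ (Fin d), Real.exp (-‖x‖ ^ α) =
      LinkParams.unitBallVolume d * Real.Gamma (d / α + 1) := by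
  have hΓ : 0 < Real.Gamma (d / α + 1) := Real.Gamma_pos_of_pos (by positivity)
  have h := measure_unitBall_eq_integral_div_gamma
    (volume : Measure (EuclideanSpace ℝ (Fin d))) hα
  rw [finrank_euclideanSpace_fin] at h
  rw [LinkParams.unitBallVolume, h, ENNReal.toReal_ofReal
    (div_nonneg (integral_nonneg fun x => (Real.exp_pos _).le) hΓ.le), div_mul_cancel₀ _ hΓ.ne']

/-- Scaling by `y^(1/α)` reduces this to `y = 1`, at the cost of the Jacobian `y^(-d/α)`. -/
lemma lintegral_exp_neg_mul_norm_rpow {α y : ℝ} (hα : 0 < α) (hy : 0 < y) :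
    ∫⁻ x : EuclideanSpace ℝ (Fin d), ENNReal.ofReal (Real.exp (-(y * ‖x‖ ^ α))) =
      ENNReal.ofReal (LinkParams.unitBallVolume d * Real.Gamma (d / α + 1) * y ^ (-(d / α))) := by
  have hΓ : 0 < Real.Gamma (d / α + 1) := Real.Gamma_pos_of_pos (by positivity)
  have hyα : 0 < y ^ (1 / α) := Real.rpow_pos_of_pos hy _
  have h := Measure.integral_comp_smul (volume : Measure (EuclideanSpace ℝ (Fin d)))
    (fun x => Real.exp (-‖x‖ ^ α)) (y ^ (1 / α))
  have hnorm : ∀ x : EuclideanSpace ℝ (Fin d), ‖y ^ (1 / α) • x‖ ^ α = y * ‖x‖ ^ α := by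
    intro x
    rw [norm_smul, Real.norm_of_nonneg hyα.le, Real.mul_rpow hyα.le (norm_nonneg _),
      ← Real.rpow_mul hy.le, one_div_mul_cancel hα.ne', Real.rpow_one]
  have hpow : |((y ^ (1 / α)) ^ d)⁻¹| = y ^ (-(d / α)) := by
    rw [abs_of_pos (by positivity), ← Real.rpow_natCast, ← Real.rpow_mul hy.le,
      Real.rpow_neg hy.le]
    congr 2; ring
  simp_rw [hnorm] at h
  rw [integral_exp_neg_norm_rpow hα, finrank_euclideanSpace_fin, hpow, smul_eq_mul, mul_comm] at h
  rw [← h, ofReal_integral_eq_lintegral_ofReal]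
  · refine Integrable.of_integral_ne_zero (h ▸ ?_)
    have := unitBallVolume_pos d
    have := Real.rpow_pos_of_pos hy (-(d / α))
    positivity
  · exact .of_forall fun x => (Real.exp_pos _).le

/-- Write `1/t = ∫ e^(-ty) dy` with `t = |x|^α + s` and exchange the integrals. The spatial integral
yields `y^(-d/α)`, and the remaining Gamma integral in `y` converges at `0` because `α > d`. -/
lemma lintegral_inv_norm_rpow_add {α s : ℝ} (hd : 0 < d) (hα : (d : ℝ) < α) (hs : 0 < s) :
    ∫⁻ x : EuclideanSpace ℝ (Fin d), ENNReal.ofReal (‖x‖ ^ α + s)⁻¹ =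
      ENNReal.ofReal (LinkParams.unitBallVolume d * Real.Gamma (d / α + 1) *
        Real.Gamma (1 - d / α) * s ^ (d / α - 1)) := by
  have hα0 : 0 < α := (Nat.cast_nonneg d).trans_lt hα
  have hδ : (d : ℝ) / α < 1 := (div_lt_one hα0).2 hα
  have hc : 0 ≤ LinkParams.unitBallVolume d * Real.Gamma (d / α + 1) :=
    mul_nonneg (unitBallVolume_pos d).le (Real.Gamma_pos_of_pos (by positivity)).le
  calc ∫⁻ x : EuclideanSpace ℝ (Fin d), ENNReal.ofReal (‖x‖ ^ α + s)⁻¹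
      = ∫⁻ x : EuclideanSpace ℝ (Fin d), ∫⁻ y in Set.Ioi (0 : ℝ),
          ENNReal.ofReal (Real.exp (-(s * y))) * ENNReal.ofReal (Real.exp (-(y * ‖x‖ ^ α))) := by
        refine lintegral_congr fun x => ?_
        have ht : 0 < ‖x‖ ^ α + s := by positivity
        have h := lintegral_rpow_mul_exp_neg_mul one_pos ht
        rw [Real.rpow_one, Real.Gamma_one, mul_one, one_div] at h
        rw [← h]
        refine lintegral_congr fun y => ?_
        rw [← ENNReal.ofReal_mul (Real.exp_pos _).le, ← Real.exp_add]
        simp only [sub_self, Real.rpow_zero, one_mul]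
        ring_nf
    _ = ∫⁻ y in Set.Ioi (0 : ℝ), ∫⁻ x : EuclideanSpace ℝ (Fin d),
          ENNReal.ofReal (Real.exp (-(s * y))) * ENNReal.ofReal (Real.exp (-(y * ‖x‖ ^ α))) := by
        refine lintegral_lintegral_swap (Measurable.aemeasurable ?_)
        simp only [Function.uncurry_def]
        fun_prop
    _ = ∫⁻ y in Set.Ioi (0 : ℝ),
          ENNReal.ofReal (LinkParams.unitBallVolume d * Real.Gamma (d / α + 1)) *
          ENNReal.ofReal (y ^ (1 - d / α - 1) * Real.exp (-(s * y))) := by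
        refine setLIntegral_congr_fun measurableSet_Ioi fun y hy => ?_
        have hy0 : (0 : ℝ) < y := hy
        rw [lintegral_const_mul _ (by fun_prop), lintegral_exp_neg_mul_norm_rpow hα0 hy,
          ← ENNReal.ofReal_mul (Real.exp_pos _).le, ← ENNReal.ofReal_mul hc]
        congr 1
        rw [show 1 - (d : ℝ) / α - 1 = -(d / α) by ring]; ring
    _ = _ := by
        rw [lintegral_const_mul' _ _ ENNReal.ofReal_ne_top,
          lintegral_rpow_mul_exp_neg_mul (by linarith) hs, ← ENNReal.ofReal_mul hc]
        congr 1
        rw [one_div, Real.inv_rpow hs.le, ← Real.rpow_neg hs.le,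
          show -(1 - (d : ℝ) / α) = d / α - 1 by ring]; ring

/-- The integrand dominates its version shifted by any `s > 0`, whose integral is a positive
multiple of `s^(d/α - 1)` and blows up as `s → 0`. -/
lemma lintegral_inv_norm_rpow {α : ℝ} (hd : 0 < d) (hα : (d : ℝ) < α) :
    ∫⁻ x : EuclideanSpace ℝ (Fin d), ENNReal.ofReal (‖x‖ ^ α)⁻¹ = ∞ := by
  have hα0 : 0 < α := (Nat.cast_nonneg d).trans_lt hα
  have hδ : (d : ℝ) / α < 1 := (div_lt_one hα0).2 hα
  set c := LinkParams.unitBallVolume d * Real.Gamma (d / α + 1) * Real.Gamma (1 - d / α) with hc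
  have hcpos : 0 < c := mul_pos (mul_pos (unitBallVolume_pos d)
    (Real.Gamma_pos_of_pos (by positivity))) (Real.Gamma_pos_of_pos (by linarith))
  have : Nontrivial (EuclideanSpace ℝ (Fin d)) :=
    Module.nontrivial_of_finrank_pos (R := ℝ) (by simpa using hd)
  have hle : ∀ s : ℝ, 0 < s → ENNReal.ofReal (c * s ^ (d / α - 1)) ≤
      ∫⁻ x : EuclideanSpace ℝ (Fin d), ENNReal.ofReal (‖x‖ ^ α)⁻¹ := by
    intro s hs
    rw [hc, ← lintegral_inv_norm_rpow_add hd hα hs]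
    refine lintegral_mono_ae ?_
    filter_upwards [Measure.ae_ne volume (0 : EuclideanSpace ℝ (Fin d))] with x hx
    have hx0 : 0 < ‖x‖ ^ α := Real.rpow_pos_of_pos (norm_pos_iff.2 hx) _
    exact ENNReal.ofReal_le_ofReal (inv_anti₀ hx0 (by linarith))
  -- The limit `s → 0` is taken along `s = t⁻¹` with `t → ∞`.
  have ht : Filter.Tendsto (fun t : ℝ => ENNReal.ofReal (c * t ^ (1 - d / α))) Filter.atTop
      (nhds ∞) :=
    ENNReal.tendsto_ofReal_atTop.comp ((tendsto_rpow_atTop (by linarith)).const_mul_atTop hcpos)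
  refine top_le_iff.1 (le_of_tendsto ht ?_)
  filter_upwards [Filter.eventually_gt_atTop 0] with t ht
  refine le_of_eq_of_le ?_ (hle t⁻¹ (by positivity))
  rw [Real.inv_rpow ht.le, ← Real.rpow_neg ht.le, neg_sub]

end PathLossIntegral

/-! ### The intensity integral in terms of the link constants -/

namespace LinkParams

variable {d : ℕ} (L : LinkParams d)

lemma r₀_pos : 0 < L.r₀ := norm_pos_iff.2 L.x₀_ne

lemma alpha_pos : 0 < L.alpha := (Nat.cast_nonneg d).trans_lt L.alpha_gt

/-- The factor `θ r₀^α` by which noise and interference are compared with the fading. -/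
def gain : ℝ := L.theta * L.r₀ ^ L.alpha

lemma gain_pos : 0 < L.gain := mul_pos L.theta_pos (Real.rpow_pos_of_pos L.r₀_pos _)

/-- The normalized path loss from `x` to the receiver. -/
def pathLoss (x : EuclideanSpace ℝ (Fin d)) : ℝ≥0∞ :=
  ENNReal.ofReal L.gain * ‖x‖ₑ ^ (-L.alpha)

lemma measurable_pathLoss : Measurable L.pathLoss :=
  (measurable_enorm.pow_const _).const_mul _

/-- The origin is excluded because there the path loss is `∞`, whereas real division by zero gives
`0`. -/
lemma pathLoss_eq {x : EuclideanSpace ℝ (Fin d)} (hx : x ≠ 0) :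
    L.pathLoss x = ENNReal.ofReal (L.gain / ‖x‖ ^ L.alpha) := by
  rw [pathLoss, ← ofReal_norm, ENNReal.ofReal_rpow_of_pos (norm_pos_iff.2 hx),
    ← ENNReal.ofReal_mul L.gain_pos.le, Real.rpow_neg (norm_nonneg _), div_eq_mul_inv]

/-- Euler's reflection formula, in the form in which the path loss integral produces the constant.
-/
lemma C_eq (hd : 0 < d) : L.C = Real.Gamma (L.delta + 1) * Real.Gamma (1 - L.delta) := by
  have hδ : 0 < L.delta := div_pos (by exact_mod_cast hd) L.alpha_pos
  have hπ : Real.pi * L.delta ≠ 0 := mul_ne_zero Real.pi_ne_zero hδ.ne'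
  rw [Real.Gamma_add_one hδ.ne', mul_assoc, Real.Gamma_mul_Gamma_one_sub, C,
    Real.sinc_of_ne_zero hπ, one_div_div]
  ring

/-- With `r = |x|^α` and `κ` the gain, the thinned Laplace transform is `(r + (1 - p)κ) / (r + κ)`.
Its reciprocal minus one is a constant over a shifted power, and the shift vanishes exactly at `p =
1`. -/
lemma eexp_thinnedCumulant_sub_one {p : ℝ} (hp0 : 0 < p) (hp1 : p ≤ 1)
    {x : EuclideanSpace ℝ (Fin d)} (hx : x ≠ 0) :
    eexp (thinnedCumulant (ENNReal.ofReal p) (L.pathLoss x)) - 1 =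
      ENNReal.ofReal (p * L.gain) * ENNReal.ofReal (‖x‖ ^ L.alpha + (1 - p) * L.gain)⁻¹ := by
  have hκ := L.gain_pos
  have hr : 0 < ‖x‖ ^ L.alpha := Real.rpow_pos_of_pos (norm_pos_iff.2 hx) _
  have hq : 0 ≤ 1 - p := sub_nonneg.2 hp1
  set κ := L.gain
  set r := ‖x‖ ^ L.alpha
  have hlap : thinnedLaplace (ENNReal.ofReal p) (L.pathLoss x) =
      ENNReal.ofReal ((r + (1 - p) * κ) / (r + κ)) := by
    rw [thinnedLaplace, L.pathLoss_eq hx, ← ENNReal.ofReal_one, ← ENNReal.ofReal_sub _ hp0.le,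
      ← ENNReal.ofReal_add zero_le_one (by positivity), ← ENNReal.ofReal_inv_of_pos (by positivity),
      ← ENNReal.ofReal_mul hp0.le, ← ENNReal.ofReal_add hq (by positivity)]
    congr 1
    change 1 - p + p * (1 + κ / r)⁻¹ = _
    field_simp
    ring
  have hs : 0 < r + (1 - p) * κ := by positivity
  rw [eexp_thinnedCumulant (by simpa using hp1), hlap,
    ← ENNReal.ofReal_inv_of_pos (by positivity), ← ENNReal.ofReal_one,
    ← ENNReal.ofReal_sub _ zero_le_one, ← ENNReal.ofReal_mul (by positivity)]
  congr 1
  field_simp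
  ring

/-- The intensity measure of the interferers. -/
def intensity : Measure (EuclideanSpace ℝ (Fin d)) := ENNReal.ofReal L.lam • volume

lemma lintegral_intensity (hd : 0 < d) {p : ℝ} (hp0 : 0 < p) (hp1 : p ≤ 1) :
    ∫⁻ x, (eexp (thinnedCumulant (ENNReal.ofReal p) (L.pathLoss x)) - 1) ∂L.intensity =
      ENNReal.ofReal (L.lam * (p * L.gain)) * ∫⁻ x : EuclideanSpace ℝ (Fin d),
        ENNReal.ofReal (‖x‖ ^ L.alpha + (1 - p) * L.gain)⁻¹ := by
  have : Nontrivial (EuclideanSpace ℝ (Fin d)) :=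
    Module.nontrivial_of_finrank_pos (R := ℝ) (by simpa using hd)
  rw [intensity, lintegral_smul_measure, smul_eq_mul, ENNReal.ofReal_mul L.lam_pos.le, mul_assoc]
  congr 1
  rw [← lintegral_const_mul' _ _ ENNReal.ofReal_ne_top]
  refine lintegral_congr_ae ?_
  filter_upwards [Measure.ae_ne volume (0 : EuclideanSpace ℝ (Fin d))] with x hx
  exact L.eexp_thinnedCumulant_sub_one hp0 hp1 hx

lemma A_nonneg (hd : 0 < d) : 0 ≤ L.A := by
  have hδ : L.delta < 1 := (div_lt_one L.alpha_pos).2 L.alpha_gt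
  have hδ0 : 0 < L.delta := div_pos (by exact_mod_cast hd) L.alpha_pos
  have := L.lam_pos
  have := unitBallVolume_pos d
  have := L.r₀_pos
  have := L.theta_pos
  have := Real.Gamma_pos_of_pos (show 0 < L.delta + 1 by linarith)
  have := Real.Gamma_pos_of_pos (show 0 < 1 - L.delta by linarith)
  rw [A, L.C_eq hd]
  positivity

lemma lintegral_intensity_of_lt_one (hd : 0 < d) {p : ℝ} (hp0 : 0 < p) (hp1 : p < 1) :
    ∫⁻ x, (eexp (thinnedCumulant (ENNReal.ofReal p) (L.pathLoss x)) - 1) ∂L.intensity =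
      ENNReal.ofReal (p * L.A / (1 - p) ^ (1 - L.delta)) := by
  have hκ := L.gain_pos
  have hq : 0 < 1 - p := sub_pos.2 hp1
  have hlam := L.lam_pos
  rw [L.lintegral_intensity hd hp0 hp1.le,
    lintegral_inv_norm_rpow_add hd L.alpha_gt (mul_pos hq hκ), ← ENNReal.ofReal_mul (by positivity)]
  congr 1
  -- Here `α δ = d` turns the power of `r₀^α` into `r₀^d`.
  have hgain : L.gain * L.gain ^ (L.delta - 1) = L.theta ^ L.delta * L.r₀ ^ d := by
    rw [Real.rpow_sub_one hκ.ne', mul_div_cancel₀ _ hκ.ne', gain,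
      Real.mul_rpow L.theta_pos.le (Real.rpow_nonneg L.r₀_pos.le _),
      ← Real.rpow_mul L.r₀_pos.le, delta, mul_div_cancel₀ _ L.alpha_pos.ne', Real.rpow_natCast]
  change L.lam * (p * L.gain) * (unitBallVolume d * Real.Gamma (L.delta + 1) *
    Real.Gamma (1 - L.delta) * ((1 - p) * L.gain) ^ (L.delta - 1)) = _
  rw [Real.mul_rpow hq.le hκ.le, A, L.C_eq hd, div_eq_mul_inv, ← Real.rpow_neg hq.le, neg_sub]
  linear_combination (L.lam * p * unitBallVolume d * Real.Gamma (L.delta + 1) *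
    Real.Gamma (1 - L.delta) * (1 - p) ^ (L.delta - 1)) * hgain

lemma lintegral_intensity_one (hd : 0 < d) :
    ∫⁻ x, (eexp (thinnedCumulant (ENNReal.ofReal 1) (L.pathLoss x)) - 1) ∂L.intensity = ∞ := by
  rw [L.lintegral_intensity hd one_pos le_rfl]
  simp only [sub_self, zero_mul, add_zero]
  rw [lintegral_inv_norm_rpow hd L.alpha_gt, ENNReal.mul_top]
  have := L.lam_pos
  have := L.gain_pos
  simp only [ne_eq, ENNReal.ofReal_eq_zero, not_le]
  positivity

end LinkParams

/-! ### Slots of the network and averaging over locations -/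

/-- Clearing denominators is valid even if noise plus interference is `0` or `∞`, since the
threshold is positive and finite. -/
lemma lt_sinr_iff {d : ℕ} {Ω : Type*} (L : LinkParams d) (X : ℕ → Ω → EuclideanSpace ℝ (Fin d))
    (h : ℕ → Node → Ω → ℝ) (k : ℕ) (noise : ℝ) (active : ℕ → Prop) (ω : Ω) :
    ENNReal.ofReal L.theta < sinr L X h k noise active ω ↔
      ENNReal.ofReal L.gain * (ENNReal.ofReal noise + interference L X h k active ω) <
        ENNReal.ofReal (h k none ω) := by
  have hr : 0 < L.r₀ ^ L.alpha := Real.rpow_pos_of_pos L.r₀_pos _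
  have h0 : ENNReal.ofReal (L.r₀ ^ L.alpha) ≠ 0 := by simpa using hr
  rw [sinr, ENNReal.lt_div_iff_mul_lt (Or.inr ENNReal.ofReal_ne_top)
      (Or.inr (by simpa using L.theta_pos)), Real.rpow_neg L.r₀_pos.le,
    ENNReal.ofReal_mul' (by positivity), ENNReal.ofReal_inv_of_pos hr, ← div_eq_mul_inv,
    ENNReal.lt_div_iff_mul_lt (Or.inl h0) (Or.inl ENNReal.ofReal_ne_top), LinkParams.gain,
    ENNReal.ofReal_mul L.theta_pos.le, mul_right_comm]

/-- The slot is successful for the MAC states in `T` and the interferers at `x`. -/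
def slotSuccess {d : ℕ} {M : Type*} (L : LinkParams d) (noise : ℝ) (T : Set M)
    (x : ℕ → EuclideanSpace ℝ (Fin d)) : Set (Node → ℝ × M) :=
  linkSuccess T (ENNReal.ofReal L.gain * ENNReal.ofReal noise) fun i => L.pathLoss (x i)

/-- The fading and the MAC states of all nodes in slot `k`. -/
def slotState {Ω M : Type*} (h : ℕ → Node → Ω → ℝ) (m : ℕ → Node → Ω → M) (k : ℕ) (ω : Ω) : Node → ℝ × M :=
  fun x => (h k x ω, m k x ω)

-- Common description of both schemes: `T = {true}` for ALOHA, and `T = {s}` for FHMA on the event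
-- that the desired transmitter uses sub-band `s`.
open Classical in
lemma slotState_mem_slotSuccess {d : ℕ} {Ω M : Type*} (L : LinkParams d)
    (X : ℕ → Ω → EuclideanSpace ℝ (Fin d)) (h : ℕ → Node → Ω → ℝ) (m : ℕ → Node → Ω → M)
    (noise : ℝ) (T : Set M) (k : ℕ) (ω : Ω) :
    slotState h m k ω ∈ slotSuccess L noise T (fun i => X i ω) ↔
      m k none ω ∈ T ∧ ENNReal.ofReal L.theta <
        sinr L X h k noise (fun i => m k (some i) ω ∈ T) ω := by
  rw [lt_sinr_iff, interference, mul_add, ← ENNReal.tsum_mul_left]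
  simp only [slotSuccess, linkSuccess, slotState, Set.mem_ofPred_eq]
  refine and_congr_right fun _ => ?_
  have : ∀ i, received T (L.pathLoss (X i ω)) (h k (some i) ω, m k (some i) ω) =
      ENNReal.ofReal L.gain * if m k (some i) ω ∈ T then
        ENNReal.ofReal (h k (some i) ω) * ‖X i ω‖ₑ ^ (-L.alpha) else 0 := by
    intro i
    simp only [received, LinkParams.pathLoss]
    split_ifs <;> ring
  simp_rw [this]

section Network

variable {d : ℕ} {L : LinkParams d} {Ω M : Type*} [MeasurableSpace Ω] [MeasurableSpace M]
  {P : Measure Ω} {X : ℕ → Ω → EuclideanSpace ℝ (Fin d)} {h : ℕ → Node → Ω → ℝ}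
  {m : ℕ → Node → Ω → M}

lemma measurableSet_slotSuccess (L : LinkParams d) (noise : ℝ) {T : Set M} (hT : MeasurableSet T) :
    MeasurableSet {z : (ℕ → EuclideanSpace ℝ (Fin d)) × (Node → ℝ × M) |
      z.2 ∈ slotSuccess L noise T z.1} := by
  have hnode : ∀ n : Node, Measurable fun z : (ℕ → EuclideanSpace ℝ (Fin d)) × (Node → ℝ × M) =>
      z.2 n := fun n => (measurable_pi_apply n).comp measurable_snd
  refine MeasurableSet.inter ((hnode none).snd hT) (measurableSet_lt ?_
    (hnode none).fst.ennreal_ofReal)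
  refine (Measurable.tsum fun i => ?_).const_add _
  refine Measurable.ite ((hnode (some i)).snd hT) ?_ measurable_const
  exact (hnode (some i)).fst.ennreal_ofReal.mul
    (L.measurable_pathLoss.comp ((measurable_pi_apply i).comp measurable_fst))

namespace IsBipolarNetwork

lemma iIndepFun_state (hnet : IsBipolarNetwork L P X h m) :
    iIndepFun (fun (q : ℕ × Node) ω => (h q.1 q.2 ω, m q.1 q.2 ω)) P :=
  hnet.indep_fading.prodMk_of_indepFun (fun q => hnet.measurable_fading q.1 q.2)
    (fun q => hnet.measurable_mac q.1 q.2) hnet.indep_mac hnet.indep_fading_mac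

lemma measurable_state (hnet : IsBipolarNetwork L P X h m) (k : ℕ) (x : Node) :
    Measurable fun ω => (h k x ω, m k x ω) :=
  (hnet.measurable_fading k x).prodMk (hnet.measurable_mac k x)

/-- The probability of success for given locations of the interferers. -/
lemma measure_slotSuccess [IsProbabilityMeasure P] (hnet : IsBipolarNetwork L P X h m) {T : Set M} (hT : MeasurableSet T)
    {p : ℝ≥0∞} (hp : ∀ k x, P {ω | m k x ω ∈ T} = p) (noise : ℝ)
    (x : ℕ → EuclideanSpace ℝ (Fin d)) (k : ℕ) :
    P {ω | slotState h m k ω ∈ slotSuccess L noise T x} =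
      p * (eexp (ENNReal.ofReal L.gain * ENNReal.ofReal noise))⁻¹ *
        (eexp (∑' i, thinnedCumulant p (L.pathLoss (x i))))⁻¹ := by
  refine measure_linkSuccess (Z := fun n ω => (h k n ω, m k n ω)) hT (hnet.measurable_state k)
    (hnet.iIndepFun_state.precomp (g := fun n : Node => (k, n)) fun a b hab => (Prod.ext_iff.1 hab).2)
    (fun n => hnet.law_fading k n) (fun n => ?_) (fun n => hp k n) _ _
  exact hnet.indep_fading_mac.comp (measurable_pi_apply (k, n)) (measurable_pi_apply (k, n))

/-- The mean delay if a slot is successful with probability `q x` given the locations `x`. -/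
lemma lintegral_slotsUntil_slotState [IsProbabilityMeasure P]
    (hnet : IsBipolarNetwork L P X h m)
    {S : (ℕ → EuclideanSpace ℝ (Fin d)) → Set (Node → ℝ × M)}
    (hS : MeasurableSet {z : (ℕ → EuclideanSpace ℝ (Fin d)) × (Node → ℝ × M) | z.2 ∈ S z.1})
    {q : (ℕ → EuclideanSpace ℝ (Fin d)) → ℝ≥0∞}
    (hq : ∀ x k, P {ω | slotState h m k ω ∈ S x} = q x) {n : ℕ} (hn : 1 ≤ n) :
    ∫⁻ ω, slotsUntil n (fun k => slotState h m k ω ∈ S fun i => X i ω) ∂P =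
      ∫⁻ ω, n * (q fun i => X i ω)⁻¹ ∂P := by
  classical
  have hmS : ∀ k, Measurable (slotState h m k) := fun k =>
    measurable_pi_iff.2 fun x => hnet.measurable_state k x
  have hX : Measurable fun ω i => X i ω := measurable_pi_iff.2 hnet.poisson.measurable
  have hZ : Measurable fun ω k => slotState h m k ω := measurable_pi_iff.2 hmS
  have hind : IndepFun (fun ω i => X i ω) (fun ω k => slotState h m k ω) P := by
    refine hnet.indep_points.comp (φ := id) (ψ := fun y k x => (y.1 (k, x), y.2 (k, x)))
      measurable_id ?_
    fun_prop
  let F : (ℕ → EuclideanSpace ℝ (Fin d)) → (ℕ → Node → ℝ × M) → ℝ≥0∞ :=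
    fun x y => slotsUntil n fun k => y k ∈ S x
  have hF : Measurable (Function.uncurry F) := by
    refine measurable_slotsUntil (E := fun k => {z : (ℕ → EuclideanSpace ℝ (Fin d)) ×
      (ℕ → Node → ℝ × M) | z.2 k ∈ S z.1}) (fun k => ?_) hn
    exact hS.preimage (f := fun z : (ℕ → EuclideanSpace ℝ (Fin d)) × (ℕ → Node → ℝ × M) =>
      (z.1, z.2 k)) (by fun_prop)
  -- Independence of the locations from fading and MAC allows the locations to be frozen at a fixed
  -- `x`.
  refine (hind.lintegral_comp_prodMk hX hZ hF).trans (lintegral_congr fun ω => ?_)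
  generalize (fun i => X i ω) = x
  have hSx : MeasurableSet (S x) := hS.preimage measurable_prodMk_left
  refine lintegral_slotsUntil (E := fun k => {ω' | slotState h m k ω' ∈ S x})
    (fun k => hmS k hSx) (hq x) (fun k j => ?_) hn
  let U : Set (ℕ × Node) := {r | r.1 < k}
  let V : Set (ℕ × Node) := {r | r.1 = k}
  have hUV : Disjoint U V := Set.disjoint_left.2 fun r hr hr' => (ne_of_lt hr) hr'
  have hres := hnet.iIndepFun_state.indepFun_restrict_of_disjoint
    (fun r => hnet.measurable_state r.1 r.2) hUV
  -- The success events of the past slots, as sets of states indexed by `U` only. The value `∅` for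
  -- `i ≥ k` is a dummy, because the count up to `k` does not see it.
  let E' : ℕ → Set (U → ℝ × M) := fun i =>
    if hi : i < k then {y | (fun v => y ⟨(i, v), hi⟩) ∈ S x} else ∅
  have hE' : ∀ i, MeasurableSet (E' i) := by
    intro i
    simp only [E']
    split_ifs with hi
    · exact hSx.preimage (f := fun (y : U → ℝ × M) v => y ⟨(i, v), hi⟩) (by fun_prop)
    · exact MeasurableSet.empty
  have hcount : ∀ ω', successCount (fun i => ω' ∈ {ω' | slotState h m i ω' ∈ S x}) k =
      successCount ((fun r : U => (h r.1.1 r.1.2 ω', m r.1.1 r.1.2 ω')) ∈ E' ·) k := by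
    refine fun ω' => successCount_congr fun i hi => ?_
    simp only [E', dif_pos hi]
    rfl
  simp_rw [hcount]
  exact hres.measure_inter_preimage_eq_mul _ _
    (measurable_successCount hE' k (measurableSet_singleton j))
    (hSx.preimage (f := fun (y : V → ℝ × M) v => y ⟨(k, v), rfl⟩) (by fun_prop))

end IsBipolarNetwork

end Network

/-! ### Mean local delays -/

/-- Up to a constant factor the integrand is the reciprocal of the conditional success probability,
so this evaluates the average of the conditional mean delays. -/
lemma IsBipolarNetwork.lintegral_eexp_tsum_thinnedCumulant {d : ℕ} {L : LinkParams d}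
    {Ω M : Type*} [MeasurableSpace Ω] [MeasurableSpace M] {P : Measure Ω}
    {X : ℕ → Ω → EuclideanSpace ℝ (Fin d)} {h : ℕ → Node → Ω → ℝ} {m : ℕ → Node → Ω → M}
    (hnet : IsBipolarNetwork L P X h m) (p : ℝ≥0∞) :
    ∫⁻ ω, eexp (∑' i, thinnedCumulant p (L.pathLoss (X i ω))) ∂P =
      eexp (∫⁻ x, (eexp (thinnedCumulant p (L.pathLoss x)) - 1) ∂L.intensity) :=
  haveI : SigmaFinite (ENNReal.ofReal L.lam • (volume : Measure (EuclideanSpace ℝ (Fin d)))) :=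
    inferInstanceAs (SigmaFinite (L.lam.toNNReal • volume))
  hnet.poisson.lintegral_eexp_tsum
    ((measurable_thinnedCumulant p).comp L.measurable_pathLoss)

/-- The mean local delay of ALOHA as a functional of the intensity measure. -/
lemma IsAloha.lintegral_alohaDelay {d : ℕ} {L : LinkParams d} {p : ℝ} (hp0 : 0 < p)
    {Ω : Type*} [MeasurableSpace Ω] {P : Measure Ω} [IsProbabilityMeasure P]
    {X : ℕ → Ω → EuclideanSpace ℝ (Fin d)} {h : ℕ → Node → Ω → ℝ} {a : ℕ → Node → Ω → Bool}
    (haloha : IsAloha L p P X h a) :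
    ∫⁻ ω, alohaDelay L X h a ω ∂P = (ENNReal.ofReal p)⁻¹ * ENNReal.ofReal (Real.exp L.B) *
      eexp (∫⁻ x, (eexp (thinnedCumulant (ENNReal.ofReal p) (L.pathLoss x)) - 1)
        ∂L.intensity) := by
  have hnet := haloha.toIsBipolarNetwork
  have hB : ENNReal.ofReal L.gain * ENNReal.ofReal (L.W * L.N₀) = ENNReal.ofReal L.B := by
    rw [← ENNReal.ofReal_mul L.gain_pos.le, LinkParams.gain, LinkParams.B, mul_assoc _ L.W]
  have hB0 : 0 ≤ L.B := by
    rw [LinkParams.B, mul_assoc]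
    exact mul_nonneg L.gain_pos.le (mul_nonneg L.W_pos.le L.N₀_nonneg)
  have hp : ENNReal.ofReal p ≠ 0 := by simpa using hp0
  have hdelay : ∀ ω, alohaDelay L X h a ω = slotsUntil 1 fun k =>
      slotState h a k ω ∈ slotSuccess L (L.W * L.N₀) {true} fun i => X i ω := by
    intro ω
    simp only [slotState_mem_slotSuccess, Set.mem_singleton_iff]
    rfl
  simp_rw [hdelay]
  rw [hnet.lintegral_slotsUntil_slotState
    (measurableSet_slotSuccess L _ (measurableSet_singleton true))
    (hnet.measure_slotSuccess (measurableSet_singleton true) haloha.prob_transmit _) le_rfl,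
    ← hnet.lintegral_eexp_tsum_thinnedCumulant, ← eexp_ofReal hB0, hB,
    ← lintegral_const_mul' _ _ (ENNReal.mul_ne_top (ENNReal.inv_ne_top.2 hp)
      (eexp_ne_top ENNReal.ofReal_ne_top))]
  refine lintegral_congr fun ω => ?_
  rw [Nat.cast_one, one_mul, mul_assoc, ← eexp_inv_add,
    ENNReal.mul_inv (Or.inl hp) (Or.inl ENNReal.ofReal_ne_top), inv_inv, eexp_add, mul_assoc]

/-- The mean local delay of FHMA without noise as a functional of the intensity measure. -/
lemma IsFhma.lintegral_fhmaDelay {d : ℕ} {L : LinkParams d} {N : ℕ} (hN : 1 ≤ N)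
    (hnoise : L.N₀ = 0) {Ω : Type*} [MeasurableSpace Ω] {P : Measure Ω} [IsProbabilityMeasure P]
    {X : ℕ → Ω → EuclideanSpace ℝ (Fin d)} {h : ℕ → Node → Ω → ℝ} {S : ℕ → Node → Ω → Fin N}
    (hfhma : IsFhma L N P X h S) :
    ∫⁻ ω, fhmaDelay L X h S ω ∂P =
      N * eexp (∫⁻ x, (eexp (thinnedCumulant (N : ℝ≥0∞)⁻¹ (L.pathLoss x)) - 1)
        ∂L.intensity) := by
  have hnet := hfhma.toIsBipolarNetwork
  have hN0 : (N : ℝ≥0∞) ≠ 0 := by simp; omega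
  -- The success event is split by the sub-band `s` of the desired transmitter. The pieces are
  -- disjoint, and each has the probability of a noiseless ALOHA success with `p = 1/N`; the `N`
  -- equal terms cancel the factor `1/N`.
  let succ : (ℕ → EuclideanSpace ℝ (Fin d)) → Set (Node → ℝ × Fin N) := fun x =>
    ⋃ s, slotSuccess L 0 {s} x
  have hmeas : ∀ s : Fin N, MeasurableSet {z : (ℕ → EuclideanSpace ℝ (Fin d)) ×
      (Node → ℝ × Fin N) | z.2 ∈ slotSuccess L 0 {s} z.1} := fun s =>
    measurableSet_slotSuccess L 0 (measurableSet_singleton s)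
  have hsucc : MeasurableSet {z : (ℕ → EuclideanSpace ℝ (Fin d)) × (Node → ℝ × Fin N) |
      z.2 ∈ succ z.1} := by
    have := MeasurableSet.iUnion hmeas
    convert this using 1
    ext z
    simp [succ]
  have hdelay : ∀ ω, fhmaDelay L X h S ω = slotsUntil N fun k =>
      slotState h S k ω ∈ succ fun i => X i ω := by
    intro ω
    simp only [succ, Set.mem_iUnion, slotState_mem_slotSuccess, Set.mem_singleton_iff,
      exists_eq_left']
    rw [fhmaDelay]
    simp only [FhmaSuccess, hnoise, mul_zero, zero_div]
  have hq : ∀ x k, P {ω | slotState h S k ω ∈ succ x} =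
      (eexp (∑' i, thinnedCumulant (N : ℝ≥0∞)⁻¹ (L.pathLoss (x i))))⁻¹ := by
    intro x k
    have hms : Measurable (slotState h S k) := measurable_pi_iff.2 (hnet.measurable_state k)
    have hU : {ω | slotState h S k ω ∈ succ x} =
        ⋃ s, {ω | slotState h S k ω ∈ slotSuccess L 0 {s} x} := by
      ext ω; simp [succ]
    rw [hU, measure_iUnion, tsum_fintype]
    · have hs : ∀ s, P {ω | slotState h S k ω ∈ slotSuccess L 0 {s} x} = (N : ℝ≥0∞)⁻¹ *
          (eexp (∑' i, thinnedCumulant (N : ℝ≥0∞)⁻¹ (L.pathLoss (x i))))⁻¹ := by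
        intro s
        rw [hnet.measure_slotSuccess (measurableSet_singleton s)
          (fun k n => hfhma.prob_subband k n s)]
        simp
      simp only [hs, Finset.sum_const, Finset.card_univ, Fintype.card_fin, nsmul_eq_mul]
      rw [← mul_assoc, ENNReal.mul_inv_cancel hN0 (ENNReal.natCast_ne_top N), one_mul]
    · intro s t hst
      refine Set.disjoint_left.2 fun ω h1 h2 => hst ?_
      exact (show S k none ω = s from h1.1).symm.trans (show S k none ω = t from h2.1)
    · exact fun s => hms ((hmeas s).preimage measurable_prodMk_left)
  simp_rw [hdelay]
  rw [hnet.lintegral_slotsUntil_slotState hsucc hq hN,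
    ← hnet.lintegral_eexp_tsum_thinnedCumulant,
    ← lintegral_const_mul' _ _ (ENNReal.natCast_ne_top N)]
  simp_rw [inv_inv]

end

theorem theorem3 {d : ℕ} (hd : 0 < d) (L : LinkParams d) (p : ℝ) (hp0 : 0 < p) (hp1 : p ≤ 1)
    {Ω : Type*} [MeasurableSpace Ω] (P : Measure Ω) [IsProbabilityMeasure P]
    (X : ℕ → Ω → EuclideanSpace ℝ (Fin d)) (h : ℕ → Node → Ω → ℝ) (a : ℕ → Node → Ω → Bool)
    (haloha : IsAloha L p P X h a) :
    (p < 1 → ∫⁻ ω, alohaDelay L X h a ω ∂P =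
      ENNReal.ofReal (1 / p * Real.exp (p * L.A / (1 - p) ^ (1 - L.delta) + L.B))) ∧
    (p = 1 → ∫⁻ ω, alohaDelay L X h a ω ∂P = ∞) ∧
    (∀ N : ℕ, 1 ≤ N → p = 1 / (N : ℝ) → L.N₀ = 0 →
      ∀ {Ω' : Type*} [MeasurableSpace Ω'] (P' : Measure Ω') [IsProbabilityMeasure P']
        (X' : ℕ → Ω' → EuclideanSpace ℝ (Fin d)) (h' : ℕ → Node → Ω' → ℝ)
        (S : ℕ → Node → Ω' → Fin N), IsFhma L N P' X' h' S →
      ∫⁻ ω, alohaDelay L X h a ω ∂P = ∫⁻ ω, fhmaDelay L X' h' S ω ∂P') := by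
  rw [haloha.lintegral_alohaDelay hp0]
  refine ⟨fun hp => ?_, fun hp => ?_, ?_⟩
  · have hA : 0 ≤ p * L.A / (1 - p) ^ (1 - L.delta) :=
      div_nonneg (mul_nonneg hp0.le (L.A_nonneg hd)) (Real.rpow_nonneg (by linarith) _)
    rw [L.lintegral_intensity_of_lt_one hd hp0 hp, eexp_ofReal hA,
      ← ENNReal.ofReal_inv_of_pos hp0, ← ENNReal.ofReal_mul (by positivity),
      ← ENNReal.ofReal_mul (by positivity), one_div, add_comm, Real.exp_add, mul_assoc]
  · subst hp
    rw [L.lintegral_intensity_one hd, eexp_top, ENNReal.mul_top]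
    simp [Real.exp_pos]
  · intro N hN hpN hnoise Ω' _ P' _ X' h' S hfhma
    have hN0 : (0 : ℝ) < N := by exact_mod_cast hN
    have hp : ENNReal.ofReal p = (N : ℝ≥0∞)⁻¹ := by
      rw [hpN, one_div, ENNReal.ofReal_inv_of_pos hN0, ENNReal.ofReal_natCast]
    have hB : L.B = 0 := by rw [LinkParams.B, hnoise, mul_zero]
    rw [hfhma.lintegral_fhmaDelay hN hnoise, hp, hB, inv_inv]
    simp
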